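/- Let $p$ be a prime, and equip $\mathbb{P}^1(\mathbb{Q}_p)$ with the spherical metric $$\rho([x_1:y_1],[x_2:y_2])=\frac{|x_1y_2-x_2y_1|_p}{\max\{|x_1|_p,|y_1|_p\}\,\max\{|x_2|_p,|y_2|_p\}};$$ a ball is a set $\{x:\rho(x,a)\le p^{-n}\}$ with $a\in\mathbb{P}^1(\mathbb{Q}_p)$ and $n\ge 1$. Let $\phi\in\mathbb{Q}_p(z)$ be a rational map of degree $\deg\phi\ge 2$, the degree being the maximum of the degrees of numerator and denominator in lowest terms. Assume that $\phi$ has good reduction: writing $\phi=f/g$ with $f,g\in\mathbb{Z}_p[z]$ without common factor and such that some coefficient of $f$ or $g$ has absolute value $1$, the reduction $\overline{\phi}=\overline{f}/\overline{g}$ over $\mathbb{F}_p$ has degree $\deg\overline{\phi}=\deg\phi$. A nonempty set $E\subseteq\mathbb{P}^1(\mathbb{Q}_p)$ is called a minimal component of $\phi$ if it is clopen, $\phi(E)\subseteq E$, and for every $x\in E$ the orbit $\{\phi^n(x):n\ge 0\}$ is dense in $E$. The attracting basin of a nonempty set $E$ is the set of points $x$ such that the distance $\rho(\phi^n(x),E)$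 tends to $0$ as $n\to\infty$. Then there is a decomposition into pairwise disjoint sets $$\mathbb{P}^1(\mathbb{Q}_p)=\mathcal{P}\sqcup\mathcal{M}\sqcup\mathcal{B},$$ where $\mathcal{P}$ is the set of all periodic points of $\phi$, and it is finite; $\mathcal{M}=\bigsqcup_i\mathcal{M}_i$ is the union of all minimal components $\mathcal{M}_i$ of $\phi$, which are pairwise disjoint, at most countably many, and each a finite union of balls; and every point of $\mathcal{B}$ lies in the attracting basin of a periodic orbit or of a minimal component. Moreover, the length of every periodic orbit of $\phi$ has one of the forms $$k\ \text{ or }\ k\ell\quad\text{if } p\ge 5,\qquad\qquad k\ \text{ or }\ k\ell\ \text{ or }\ kp\quad\text{if } p=2\text{ or }3,$$ where $k,\ell$ are positive integers with $1\le k\le p+1$ and $\ell\mid(p-1)$. -/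

import Mathlib

open scoped LinearAlgebra.Projectivization Polynomial Topology

noncomputable section

namespace PadicRat

/-! ### Rational maps on the projective line over a field -/

/-- The degree of a rational map: the maximum of the degrees of the numerator and the denominator
in lowest terms. -/
def ratDegree {K : Type*} [Field K] (φ : RatFunc K) : ℕ :=
  max φ.num.natDegree φ.denom.natDegree

/-- The value at `v = (x, y)` of the degree `d` homogenization `∑ aᵢ xⁱ y^(d-i)` of the polynomial
`f = ∑ aᵢ zⁱ`. -/
def homEval {K : Type*} [Field K] (d : ℕ) (f : K[X]) (v : Fin 2 → K) : K :=
  ∑ i ∈ Finset.range (d + 1), f.coeff i * v 0 ^ i * v 1 ^ (d - i)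

theorem homEval_smul {K : Type*} [Field K] (d : ℕ) (f : K[X]) (t : K) (v : Fin 2 → K) :
    homEval d f (t • v) = t ^ d * homEval d f v := by
  unfold homEval
  rw [Finset.mul_sum]
  refine Finset.sum_congr rfl fun i hi => ?_
  have hi' : i ≤ d := Nat.lt_succ_iff.mp (Finset.mem_range.mp hi)
  have : t ^ d = t ^ i * t ^ (d - i) := by rw [← pow_add, Nat.add_sub_cancel' hi']
  simp only [Pi.smul_apply, smul_eq_mul, mul_pow, this]
  ring

theorem homEval_eq_eval {K : Type*} [Field K] {d : ℕ} {f : K[X]} (hf : f.natDegree ≤ d)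
    {v : Fin 2 → K} (hv : v 1 ≠ 0) : homEval d f v = v 1 ^ d * f.eval (v 0 / v 1) := by
  unfold homEval
  rw [Polynomial.eval_eq_sum_range' (Nat.lt_succ_of_le hf), Finset.mul_sum]
  refine Finset.sum_congr rfl fun i hi => ?_
  have hi' : i ≤ d := Nat.lt_succ_iff.mp (Finset.mem_range.mp hi)
  have : v 1 ^ d = v 1 ^ i * v 1 ^ (d - i) := by rw [← pow_add, Nat.add_sub_cancel' hi']
  rw [this, div_pow]
  field_simp

theorem homEval_of_eq_zero {K : Type*} [Field K] (d : ℕ) (f : K[X])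
    {v : Fin 2 → K} (hv : v 1 = 0) : homEval d f v = f.coeff d * v 0 ^ d := by
  unfold homEval
  rw [Finset.sum_eq_single d]
  · simp
  · intro i hi hne
    have hi' : i ≤ d := Nat.lt_succ_iff.mp (Finset.mem_range.mp hi)
    rw [hv, zero_pow (by omega), mul_zero]
  · simp

/-- The homogeneous lift `(x, y) ↦ (F (x, y), G (x, y))` of a rational map `φ = f / g`, where `F`
and `G` are the homogenizations of `f` and `g` of degree `deg φ`. -/
def homLift {K : Type*} [Field K] (φ : RatFunc K) (v : Fin 2 → K) : Fin 2 → K :=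
  ![homEval (ratDegree φ) φ.num v, homEval (ratDegree φ) φ.denom v]

theorem homLift_ne_zero {K : Type*} [Field K] (φ : RatFunc K) {v : Fin 2 → K} (hv : v ≠ 0) :
    homLift φ v ≠ 0 := by
  intro h
  have h0 : homEval (ratDegree φ) φ.num v = 0 := congrFun h 0
  have h1 : homEval (ratDegree φ) φ.denom v = 0 := congrFun h 1
  by_cases hv1 : v 1 = 0
  · have hv0 : v 0 ≠ 0 := by
      intro hv0
      apply hv
      funext i
      fin_cases i
      · exact hv0
      · exact hv1
    rw [homEval_of_eq_zero _ _ hv1] at h0 h1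
    have c0 : φ.num.coeff (ratDegree φ) = 0 :=
      (mul_eq_zero.mp h0).resolve_right (pow_ne_zero _ hv0)
    have c1 : φ.denom.coeff (ratDegree φ) = 0 :=
      (mul_eq_zero.mp h1).resolve_right (pow_ne_zero _ hv0)
    have hd : φ.denom ≠ 0 := φ.denom_ne_zero
    rcases le_total φ.num.natDegree φ.denom.natDegree with hle | hle
    · rw [ratDegree, max_eq_right hle] at c1
      exact hd (Polynomial.leadingCoeff_eq_zero.mp c1)
    · rw [ratDegree, max_eq_left hle] at c0 c1
      have hn : φ.num = 0 := Polynomial.leadingCoeff_eq_zero.mp c0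
      rw [hn, Polynomial.natDegree_zero] at hle c1
      have : φ.denom.natDegree = 0 := Nat.le_zero.mp hle
      rw [← this] at c1
      exact hd (Polynomial.leadingCoeff_eq_zero.mp c1)
  · rw [homEval_eq_eval (show φ.num.natDegree ≤ ratDegree φ from le_max_left _ _) hv1] at h0
    rw [homEval_eq_eval (show φ.denom.natDegree ≤ ratDegree φ from le_max_right _ _) hv1] at h1
    have e0 := (mul_eq_zero.mp h0).resolve_left (pow_ne_zero _ hv1)
    have e1 := (mul_eq_zero.mp h1).resolve_left (pow_ne_zero _ hv1)
    obtain ⟨a, b, hab⟩ := φ.isCoprime_num_denom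
    have := congrArg (Polynomial.eval (v 0 / v 1)) hab
    simp [e0, e1] at this

theorem homLift_smul {K : Type*} [Field K] (φ : RatFunc K) (t : K) (v : Fin 2 → K) :
    homLift φ (t • v) = t ^ ratDegree φ • homLift φ v := by
  funext i
  fin_cases i
  · simpa [homLift] using homEval_smul (ratDegree φ) φ.num t v
  · simpa [homLift] using homEval_smul (ratDegree φ) φ.denom t v

/-- The transformation of the projective line over `K` induced by a rational map. The point `z`
of `K` is `[z : 1]` and the point at infinity is `[1 : 0]`. -/
def ratMap {K : Type*} [Field K] (φ : RatFunc K) :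
    ℙ K (Fin 2 → K) → ℙ K (Fin 2 → K) :=
  Projectivization.lift
    (fun v => Projectivization.mk K (homLift φ v) (homLift_ne_zero φ v.2))
    (fun a b t h => by
      rw [Projectivization.mk_eq_mk_iff']
      exact ⟨t ^ ratDegree φ, by rw [h, homLift_smul]⟩)

/-! ### Good reduction -/

/-- The rational map `φ = f / g` over `ℚ_p`, with `f` and `g` in `ℤ_p[z]` without common factor and
at least one coefficient of `f` or `g` of absolute value `1`, has good reduction: the rational
function `f̄ / ḡ` over `𝔽_p` has the same degree as `φ`. (If `ḡ = 0`, the reduction is the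
constant map `∞`, of degree `0`, and the quotient below is the constant `0`, also of
degree `0`.) -/
def GoodReduction (p : ℕ) [Fact p.Prime] (φ : RatFunc ℚ_[p]) : Prop :=
  ∃ f g : ℤ_[p][X],
    IsCoprime (f.map (algebraMap ℤ_[p] ℚ_[p])) (g.map (algebraMap ℤ_[p] ℚ_[p])) ∧
    φ = algebraMap ℚ_[p][X] (RatFunc ℚ_[p]) (f.map (algebraMap ℤ_[p] ℚ_[p])) /
        algebraMap ℚ_[p][X] (RatFunc ℚ_[p]) (g.map (algebraMap ℤ_[p] ℚ_[p])) ∧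
    g ≠ 0 ∧
    (∃ i, ‖f.coeff i‖ = 1 ∨ ‖g.coeff i‖ = 1) ∧
    ratDegree
      (algebraMap (ZMod p)[X] (RatFunc (ZMod p)) (f.map (PadicInt.toZMod (p := p))) /
        algebraMap (ZMod p)[X] (RatFunc (ZMod p)) (g.map (PadicInt.toZMod (p := p)))) =
      ratDegree φ

/-! ### The projective line over `ℚ_p` with its spherical metric -/

/-- The projective line over `ℚ_p`. -/
abbrev P1 (p : ℕ) [Fact p.Prime] : Type := ℙ ℚ_[p] (Fin 2 → ℚ_[p])

/-- `|x₁ y₂ - x₂ y₁| / (max |x₁| |y₁| * max |x₂| |y₂|)` for vectors `(x₁, y₁)` and `(x₂, y₂)`. -/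
def sphVec (p : ℕ) [Fact p.Prime] (v w : Fin 2 → ℚ_[p]) : ℝ :=
  ‖v 0 * w 1 - w 0 * v 1‖ / (max ‖v 0‖ ‖v 1‖ * max ‖w 0‖ ‖w 1‖)

theorem max_norm_pos (p : ℕ) [Fact p.Prime] {v : Fin 2 → ℚ_[p]} (hv : v ≠ 0) :
    0 < max ‖v 0‖ ‖v 1‖ := by
  by_contra h
  rw [not_lt, max_le_iff, norm_le_zero_iff, norm_le_zero_iff] at h
  apply hv
  funext i
  fin_cases i
  · exact h.1
  · exact h.2

theorem sphVec_comm (p : ℕ) [Fact p.Prime] (v w : Fin 2 → ℚ_[p]) :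
    sphVec p v w = sphVec p w v := by
  unfold sphVec
  rw [norm_sub_rev, mul_comm (max ‖v 0‖ ‖v 1‖)]

theorem sphVec_smul_left (p : ℕ) [Fact p.Prime] {t : ℚ_[p]} (ht : t ≠ 0)
    (v w : Fin 2 → ℚ_[p]) : sphVec p (t • v) w = sphVec p v w := by
  unfold sphVec
  have h1 : (t • v) 0 * w 1 - w 0 * (t • v) 1 = t * (v 0 * w 1 - w 0 * v 1) := by
    simp only [Pi.smul_apply, smul_eq_mul]; ring
  have h2 : max ‖(t • v) 0‖ ‖(t • v) 1‖ = ‖t‖ * max ‖v 0‖ ‖v 1‖ := by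
    simp only [Pi.smul_apply, smul_eq_mul, norm_mul]
    rw [mul_max_of_nonneg _ _ (norm_nonneg t)]
  rw [h1, h2, norm_mul, mul_assoc, mul_div_mul_left _ _ (norm_ne_zero_iff.mpr ht)]

theorem sphVec_triangle (p : ℕ) [Fact p.Prime] {u v w : Fin 2 → ℚ_[p]}
    (hu : u ≠ 0) (hv : v ≠ 0) (hw : w ≠ 0) :
    sphVec p u w ≤ max (sphVec p u v) (sphVec p v w) := by
  have pu := max_norm_pos p hu
  have pv := max_norm_pos p hv
  have pw := max_norm_pos p hw
  unfold sphVec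
  set a := max ‖u 0‖ ‖u 1‖ with ha
  set b := max ‖v 0‖ ‖v 1‖ with hb
  set c := max ‖w 0‖ ‖w 1‖ with hc
  have key : ∀ i : Fin 2, ‖u 0 * w 1 - w 0 * u 1‖ * ‖v i‖ ≤
      max (‖u 0 * v 1 - v 0 * u 1‖ * c) (‖v 0 * w 1 - w 0 * v 1‖ * a) := by
    intro i
    have e : (u 0 * w 1 - w 0 * u 1) * v i =
        (u 0 * v 1 - v 0 * u 1) * w i + (v 0 * w 1 - w 0 * v 1) * u i := by
      fin_cases i <;> simp <;> ring
    rw [← norm_mul, e]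
    refine (Padic.nonarchimedean _ _).trans ?_
    rw [norm_mul, norm_mul]
    refine max_le_max (mul_le_mul_of_nonneg_left ?_ (norm_nonneg _))
      (mul_le_mul_of_nonneg_left ?_ (norm_nonneg _))
    · fin_cases i
      · exact le_max_left _ _
      · exact le_max_right _ _
    · fin_cases i
      · exact le_max_left _ _
      · exact le_max_right _ _
  have key' : ‖u 0 * w 1 - w 0 * u 1‖ * b ≤
      max (‖u 0 * v 1 - v 0 * u 1‖ * c) (‖v 0 * w 1 - w 0 * v 1‖ * a) := by
    rcases max_choice ‖v 0‖ ‖v 1‖ with h | h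
    · rw [hb, h]; exact key 0
    · rw [hb, h]; exact key 1
  rcases le_max_iff.mp key' with h | h
  · refine le_max_of_le_left ?_
    rw [div_le_div_iff₀ (mul_pos pu pw) (mul_pos pu pv)]
    nlinarith [mul_le_mul_of_nonneg_left h pu.le]
  · refine le_max_of_le_right ?_
    rw [div_le_div_iff₀ (mul_pos pu pw) (mul_pos pv pw)]
    nlinarith [mul_le_mul_of_nonneg_left h pw.le]

/-- The spherical metric on the projective line over `ℚ_p`, computed on any homogeneous
coordinates. -/
def sphDist (p : ℕ) [Fact p.Prime] (P Q : P1 p) : ℝ := sphVec p P.rep Q.rep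

theorem sphDist_mk (p : ℕ) [Fact p.Prime] (v w : Fin 2 → ℚ_[p]) (hv : v ≠ 0) (hw : w ≠ 0) :
    sphDist p (Projectivization.mk ℚ_[p] v hv) (Projectivization.mk ℚ_[p] w hw) =
      sphVec p v w := by
  obtain ⟨a, ha⟩ := Projectivization.exists_smul_eq_mk_rep ℚ_[p] v hv
  obtain ⟨b, hb⟩ := Projectivization.exists_smul_eq_mk_rep ℚ_[p] w hw
  unfold sphDist
  rw [← ha, ← hb, Units.smul_def, Units.smul_def, sphVec_smul_left p a.ne_zero, sphVec_comm,
    sphVec_smul_left p b.ne_zero, sphVec_comm]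

theorem sphDist_eq_zero (p : ℕ) [Fact p.Prime] {P Q : P1 p} (h : sphDist p P Q = 0) : P = Q := by
  have hP := P.rep_nonzero
  have hQ := Q.rep_nonzero
  unfold sphDist sphVec at h
  rw [div_eq_zero_iff, norm_eq_zero] at h
  have h' := h.resolve_right (mul_pos (max_norm_pos p hP) (max_norm_pos p hQ)).ne'
  rw [← P.mk_rep, ← Q.mk_rep, Projectivization.mk_eq_mk_iff']
  generalize P.rep = v at *
  generalize Q.rep = w at *
  have h'' : v 0 * w 1 = w 0 * v 1 := sub_eq_zero.mp h'
  by_cases hw : w 0 = 0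
  · have hw1 : w 1 ≠ 0 := by
      intro hw1
      apply hQ
      funext i
      fin_cases i
      · exact hw
      · exact hw1
    refine ⟨v 1 / w 1, ?_⟩
    funext i
    fin_cases i
    · have : v 0 = 0 := by simpa [hw, hw1] using h''
      simp [hw, this]
    · simp [hw1]
  · refine ⟨v 0 / w 0, ?_⟩
    funext i
    fin_cases i
    · simp [hw]
    · simp only [Fin.mk_one, Pi.smul_apply, smul_eq_mul]
      rw [div_mul_eq_mul_div, h'', mul_div_cancel_left₀ _ hw]

instance instMetricSpaceP1 (p : ℕ) [Fact p.Prime] : MetricSpace (P1 p) where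
  dist := sphDist p
  dist_self P := by
    change sphVec p P.rep P.rep = 0
    simp [sphVec]
  dist_comm P Q := sphVec_comm p _ _
  dist_triangle P Q R := by
    refine (sphVec_triangle p P.rep_nonzero Q.rep_nonzero R.rep_nonzero).trans ?_
    refine max_le_add_of_nonneg ?_ ?_ <;> exact div_nonneg (norm_nonneg _)
      (mul_nonneg (le_max_of_le_left (norm_nonneg _)) (le_max_of_le_left (norm_nonneg _)))
  eq_of_dist_eq_zero := sphDist_eq_zero p

/-- The ball `B_n(a)` of radius `p ^ (-n)` centered at `a`, for the spherical metric. -/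
def sphBall (p : ℕ) [Fact p.Prime] (n : ℕ) (a : P1 p) : Set (P1 p) :=
  Metric.closedBall a ((p : ℝ) ^ (-(n : ℤ)))

/-- `E` is the union of finitely many balls `B_n(a)` with `n ≥ 1`. -/
def IsFiniteUnionOfBalls (p : ℕ) [Fact p.Prime] (E : Set (P1 p)) : Prop :=
  ∃ S : Set (ℕ × P1 p), S.Finite ∧ (∀ s ∈ S, 1 ≤ s.1) ∧ E = ⋃ s ∈ S, sphBall p s.1 s.2

/-! ### Dynamics -/

/-- The (forward) orbit of `x` under `T`. -/
def orbit {X : Type*} (T : X → X) (x : X) : Set X := Set.range fun n : ℕ => T^[n] x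

/-- `T : E → E` is a minimal subsystem: `E` is mapped into itself, and the orbit of every point of
`E` is dense in `E`. -/
def IsMinimalSubsystem {X : Type*} [TopologicalSpace X] (T : X → X) (E : Set X) : Prop :=
  Set.MapsTo T E E ∧ ∀ x ∈ E, E ⊆ closure (orbit T x)

/-- A minimal component: a nonempty clopen invariant set on which `T` is minimal. -/
def IsMinimalComponent {X : Type*} [TopologicalSpace X] (T : X → X) (E : Set X) : Prop :=
  E.Nonempty ∧ IsClopen E ∧ IsMinimalSubsystem T E

/-- The attracting basin of a (nonempty) set `E`: the points whose iterates converge to `E`. -/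
def basin {X : Type*} [MetricSpace X] (T : X → X) (E : Set X) : Set X :=
  {x | Filter.Tendsto (fun n : ℕ => Metric.infDist (T^[n] x) E) Filter.atTop (𝓝 0)}

end PadicRat

end

open scoped LinearAlgebra.Projectivization Polynomial Topology

namespace PadicRat

/-! ### Functions that preserve congruences -/

/-! Good reduction says that `φ` is given by two forms over `ℤ_p` whose reductions have no common
zero (`GoodReduction.hasIntegralLift`). So `φ` preserves coprimality of homogeneous coordinates, is
1-Lipschitz, and maps each of the `p + 1` residue discs into another. In a coordinate `u ∈ ℤ_p` on
each disc it becomes `c + l u + p a u² + p² e(u)` with `e` 1-Lipschitz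
(`HasIntegralLift.exists_isQuad`). This class is closed under composition, so the problem reduces to
a self-map `T` of `ℤ_p` in the class: a return map of `φ` to a disc.

Modulo `p`, `T` is the affine map `x ↦ c + l x`. If `p ∣ l`, then `T` is a contraction with an
attracting fixed point. Otherwise some iterate `S` of `T` is close to the identity: `T^(p-1)` if `l
≢ 0, 1`, `T^p` if `l ≡ 1`, and `T^4` if `p = 2`. Such an `S` satisfies `‖S^n u - u‖ = ‖n‖ ‖S u - u‖`
(`NearId.norm_iterate_sub`): it fixes `u` or moves it as a translation would. In the second case the
`S`-orbit is dense in a ball and the closure of the `φ`-orbit is a finite union of balls, which is a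
minimal component (`isMinimalComponent_closure_orbit`). Every orbit meets some disc twice, so every
point is attracted to one of these objects (`HasIntegralLift.exists_attractor`).

For a periodic point, `k` is the first return time to its disc, at most `p + 1`, and the remaining
factor is the period of `T`. When `l ≡ 1` this factor could be `p`, but for `p ≥ 5` the vanishing of
`∑ x` and `∑ x²` over `𝔽_p` excludes it (`IsQuadWith.iterate_prime_ne`). Periods are therefore
bounded, and since no iterate of a map of degree at least 2 is the identity, each period contributes
finitely many points (`finite_fixedPoints_iterate`). -/

/-- `e` preserves congruences: `u - v` divides `e u - e v`. On `ℤ_p` this says that `e` is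
`1`-Lipschitz. -/
def DvdLip {R : Type*} [CommRing R] (e : R → R) : Prop := ∀ u v, u - v ∣ e u - e v

namespace DvdLip

variable {R : Type*} [CommRing R] {e f : R → R}

theorem const (c : R) : DvdLip fun _ : R => c := fun u v => by simp

theorem id : DvdLip fun u : R => u := fun _ _ => dvd_rfl

theorem add (he : DvdLip e) (hf : DvdLip f) : DvdLip fun u => e u + f u := fun u v => by
  have h := dvd_add (he u v) (hf u v)
  rwa [show e u + f u - (e v + f v) = e u - e v + (f u - f v) by ring]

theorem mul (he : DvdLip e) (hf : DvdLip f) : DvdLip fun u => e u * f u := fun u v => by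
  rw [show e u * f u - e v * f v = (e u - e v) * f u + e v * (f u - f v) by ring]
  exact dvd_add ((he u v).mul_right _) ((hf u v).mul_left _)

theorem neg (he : DvdLip e) : DvdLip fun u => -e u := fun u v => by
  rw [show -e u - -e v = -(e u - e v) by ring]
  exact (he u v).neg_right

theorem sub (he : DvdLip e) (hf : DvdLip f) : DvdLip fun u => e u - f u := by
  simpa only [sub_eq_add_neg] using he.add hf.neg

theorem pow (he : DvdLip e) (n : ℕ) : DvdLip fun u => e u ^ n := fun u v =>
  (he u v).trans (sub_dvd_pow_sub_pow _ _ n)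

theorem comp (he : DvdLip e) (hf : DvdLip f) : DvdLip fun u => e (f u) := fun u v =>
  (hf u v).trans (he _ _)

theorem eval (P : R[X]) : DvdLip fun u => P.eval u := fun u v => P.sub_dvd_eval_sub u v

theorem of_mul_eq_one (he : DvdLip e) (h : ∀ u, e u * f u = 1) : DvdLip f := fun u v => by
  have : f u - f v = (e u - e v) * (-(f u * f v)) := by
    linear_combination (-(f u)) * h v + f v * h u
  rw [this]
  exact (he u v).mul_right _

end DvdLip

/-! ### Local dynamics on `ℤ_p` -/

variable {p : ℕ} [Fact p.Prime]

/-- `T` has multiplier `l` modulo `p` and is, modulo `p ^ 2` times a `1`-Lipschitz function, a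
quadratic polynomial with leading coefficient divisible by `p`. -/
def IsQuadWith (l : ℤ_[p]) (T : ℤ_[p] → ℤ_[p]) : Prop :=
  ∃ (c a : ℤ_[p]) (e : ℤ_[p] → ℤ_[p]), DvdLip e ∧
    ∀ u, T u = c + l * u + p * a * u ^ 2 + p ^ 2 * e u

/-- `T` is quadratic in the sense of `IsQuadWith`, for some linear coefficient. -/
def IsQuad (T : ℤ_[p] → ℤ_[p]) : Prop := ∃ l, IsQuadWith l T

theorem IsQuad.id : IsQuad fun u : ℤ_[p] => u :=
  ⟨1, 0, 0, fun _ => 0, DvdLip.const 0, fun u => by ring⟩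

/-- In the outer quadratic term `p a₂ (T u)²`, the terms of degree above 2 contain a further factor
`p` and go into the error, so the shape survives. -/
theorem IsQuad.comp {S T : ℤ_[p] → ℤ_[p]} (hS : IsQuad S) (hT : IsQuad T) :
    IsQuad fun u => S (T u) := by
  obtain ⟨l₂, c₂, a₂, e₂, he₂, h₂⟩ := hS
  obtain ⟨l₁, c₁, a₁, e₁, he₁, h₁⟩ := hT
  have hT' : DvdLip T := by
    rw [show T = fun u => c₁ + l₁ * u + p * a₁ * u ^ 2 + p ^ 2 * e₁ u from funext h₁]
    exact (((DvdLip.const c₁).add ((DvdLip.const l₁).mul .id)).add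
      ((DvdLip.const _).mul (DvdLip.id.pow 2))).add ((DvdLip.const _).mul he₁)
  have hA : DvdLip fun u => c₁ + l₁ * u := (DvdLip.const c₁).add ((DvdLip.const l₁).mul .id)
  have hB : DvdLip fun u => a₁ * u ^ 2 := (DvdLip.const a₁).mul (DvdLip.id.pow 2)
  refine ⟨l₂ * l₁ + 2 * p * a₂ * c₁ * l₁, c₂ + l₂ * c₁ + p * a₂ * c₁ ^ 2,
    l₂ * a₁ + a₂ * l₁ ^ 2,
    fun u => l₂ * e₁ u + a₂ * (2 * ((c₁ + l₁ * u) * (a₁ * u ^ 2)) + p * (a₁ * u ^ 2) ^ 2 +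
      2 * p * ((c₁ + l₁ * u) * e₁ u) + 2 * p ^ 2 * ((a₁ * u ^ 2) * e₁ u) + p ^ 3 * e₁ u ^ 2) +
      e₂ (T u), ?_, fun u => ?_⟩
  · refine (((DvdLip.const _).mul he₁).add ((DvdLip.const _).mul ?_)).add (he₂.comp hT')
    exact (((((DvdLip.const 2).mul (hA.mul hB)).add ((DvdLip.const _).mul (hB.pow 2))).add
      ((DvdLip.const _).mul (hA.mul he₁))).add ((DvdLip.const _).mul (hB.mul he₁))).add
      ((DvdLip.const _).mul (he₁.pow 2))
  · beta_reduce
    rw [h₂ (T u)]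
    generalize e₂ (T u) = E
    rw [h₁ u]
    ring

theorem IsQuad.iterate {T : ℤ_[p] → ℤ_[p]} (hT : IsQuad T) (n : ℕ) : IsQuad T^[n] := by
  induction n with
  | zero => exact IsQuad.id
  | succ n ih => rw [Function.iterate_succ]; exact ih.comp hT

theorem IsQuad.dvdLip {T : ℤ_[p] → ℤ_[p]} (hT : IsQuad T) : DvdLip T := by
  obtain ⟨l, c, a, e, he, h⟩ := hT
  rw [show T = fun u => c + l * u + p * a * u ^ 2 + p ^ 2 * e u from funext h]
  exact (((DvdLip.const c).add ((DvdLip.const l).mul .id)).add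
    ((DvdLip.const _).mul (DvdLip.id.pow 2))).add ((DvdLip.const _).mul he)

/-- A quadratic map with non-unit multiplier contracts by a factor `p`. -/
theorem IsQuadWith.contracts {T : ℤ_[p] → ℤ_[p]} {l : ℤ_[p]} (hT : IsQuadWith l T)
    (hl : (p : ℤ_[p]) ∣ l) (u v : ℤ_[p]) : p * (u - v) ∣ T u - T v := by
  obtain ⟨c, a, e, he, h⟩ := hT
  obtain ⟨m, rfl⟩ := hl
  obtain ⟨r, hr⟩ := he u v
  refine ⟨m + a * (u + v) + p * r, ?_⟩
  rw [h u, h v]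
  linear_combination (p : ℤ_[p]) ^ 2 * hr

/-! ### Maps close to the identity -/

/-- The maps of `ℤ_p` close enough to the identity for the iterates to satisfy
`‖S^n u - u‖ = ‖n‖ * ‖S u - u‖`. -/
def NearId (S : ℤ_[p] → ℤ_[p]) : Prop :=
  (p ≠ 2 ∧ IsQuad S ∧ ∀ u, (p : ℤ_[p]) ∣ S u - u) ∨
    (p = 2 ∧ ∃ e : ℤ_[p] → ℤ_[p], DvdLip e ∧ ∀ u, S u = u + 4 * e u)

/-- Along the orbit of `u`, which stays congruent to `u` modulo `p`, `S` has slope `1 + p k` modulo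
`p²` with `k` constant, and `∑_{j<n} (1 + p k)^j ≡ n + p k (n choose 2)` modulo `p²`. The constancy
of `k` is where the quadratic shape is needed. -/
theorem iterate_sub_of_quad_near_id {S : ℤ_[p] → ℤ_[p]} (hS : IsQuad S)
    (hid : ∀ u, (p : ℤ_[p]) ∣ S u - u) (u : ℤ_[p]) :
    ∃ k : ℤ_[p], ∀ n : ℕ, ∃ r : ℤ_[p],
      S^[n] u - u = (S u - u) * (n + p * k * (n.choose 2 : ℕ) + p ^ 2 * r) := by
  obtain ⟨l, c, a, e, he, h⟩ := hS
  -- Closeness to the identity at the points 0 and 1 forces `c ≡ 0` and `l ≡ 1` modulo `p`.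
  obtain ⟨c', hc⟩ : (p : ℤ_[p]) ∣ c := by
    have h0 := hid 0
    rw [h 0] at h0
    have : c + l * 0 + p * a * 0 ^ 2 + p ^ 2 * e 0 - 0 = c + p * (p * e 0) := by ring
    rw [this] at h0
    exact (dvd_add_left (dvd_mul_right _ _)).mp h0
  obtain ⟨l', hl⟩ : (p : ℤ_[p]) ∣ l - 1 := by
    have h0 := hid 1
    rw [h 1] at h0
    have : c + l * 1 + p * a * 1 ^ 2 + p ^ 2 * e 1 - 1 = (l - 1) + p * (c' + a + p * e 1) := by
      rw [hc]; ring
    rw [this] at h0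
    exact (dvd_add_left (dvd_mul_right _ _)).mp h0
  have hS : ∀ x, S x = x + p * (c' + l' * x + a * x ^ 2 + p * e x) := fun x => by
    rw [h x, hc]
    linear_combination x * hl
  obtain ⟨D', hD⟩ := hid u
  -- This is `(slope - 1) / p`: the slope between `x` and `u` involves `a (x + u)`, and `x + u ≡ 2u`
  -- modulo `p`.
  refine ⟨l' + 2 * a * u, fun n => ?_⟩
  induction n with
  | zero => exact ⟨0, by simp⟩
  | succ n ih =>
    obtain ⟨r, hr⟩ := ih
    obtain ⟨s, hs⟩ := he (S^[n] u) u
    rw [Function.iterate_succ_apply']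
    set x := S^[n] u with hx
    set k := l' + 2 * a * u
    set D := S u - u with hDdef
    set w : ℤ_[p] := n + p * k * (n.choose 2 : ℕ) + p ^ 2 * r with hw
    have hx' : x = u + D * w := by linear_combination hr
    have key : S x - u = D * (w + 1 + p * k * w + p * a * D * w ^ 2 + p ^ 2 * w * s) := by
      have e1 : S x - S u = x - u + p * (l' * (x - u) + a * (x - u) * (x + u) + p * (e x - e u)) := by
        rw [hS x, hS u]; ring
      rw [hs] at e1
      have e2 : S x - u = S x - S u + D := by rw [hDdef]; ring
      rw [e2, e1, hx']
      simp only [k]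
      ring
    have hch : (((n + 1).choose 2 : ℕ) : ℤ_[p]) = n + (n.choose 2 : ℕ) := by
      rw [Nat.choose_succ_succ' n 1]; simp
    refine ⟨r + k * (k * (n.choose 2 : ℕ) + p * r) + a * D' * w ^ 2 + w * s, ?_⟩
    rw [key, hch]
    rw [hD]
    push_cast
    simp only [hw]
    ring

/-- These are the two inputs of the induction on `n`: the factor is a unit when `p ∤ n`, and `p`
times a unit when `n = p`. For odd `p` the latter uses `p ∣ p choose 2`; for `p = 2` that fails,
hence the congruence modulo 4 in `NearId`. -/
theorem NearId.exists_iterate_sub {S : ℤ_[p] → ℤ_[p]} (hS : NearId S) (u : ℤ_[p]) :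
    (∀ n : ℕ, ∃ r : ℤ_[p], S^[n] u - u = (S u - u) * (n + p * r)) ∧
      ∃ r : ℤ_[p], S^[p] u - u = (S u - u) * (p * (1 + p * r)) := by
  rcases hS with ⟨hp, hQ, hid⟩ | ⟨hp, e, he, hS⟩
  · obtain ⟨k, hk⟩ := iterate_sub_of_quad_near_id hQ hid u
    refine ⟨fun n => ?_, ?_⟩
    · obtain ⟨r, hr⟩ := hk n
      exact ⟨k * (n.choose 2 : ℕ) + p * r, by rw [hr]; ring⟩
    · obtain ⟨r, hr⟩ := hk p
      have hodd : p ∣ p.choose 2 :=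
        (Fact.out : p.Prime).dvd_choose_self (by norm_num)
          (lt_of_le_of_ne (Fact.out : p.Prime).two_le (Ne.symm hp))
      obtain ⟨m, hm⟩ := hodd
      refine ⟨k * m + r, ?_⟩
      rw [hr, hm]
      push_cast
      ring
  · subst hp
    have key : ∀ n : ℕ, ∃ r : ℤ_[2], S^[n] u - u = (S u - u) * (n + 4 * r) := by
      intro n
      induction n with
      | zero => exact ⟨0, by simp⟩
      | succ n ih =>
        obtain ⟨r, hr⟩ := ih
        obtain ⟨s, hs⟩ := he (S^[n] u) u
        rw [Function.iterate_succ_apply']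
        refine ⟨r + (n + 4 * r) * s, ?_⟩
        have h1 := hS (S^[n] u)
        have h2 := hS u
        push_cast
        linear_combination h1 - h2 + 4 * hs + (1 + 4 * s) * hr
    refine ⟨fun n => ?_, ?_⟩
    · obtain ⟨r, hr⟩ := key n
      exact ⟨2 * r, by rw [hr]; push_cast; ring⟩
    · obtain ⟨r, hr⟩ := key 2
      exact ⟨r, by rw [hr]; push_cast; ring⟩

theorem NearId.iterate_prime {S : ℤ_[p] → ℤ_[p]} (hS : NearId S) : NearId S^[p] := by
  rcases hS with ⟨hp, hQ, hid⟩ | ⟨hp, e, he, hS⟩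
  · refine Or.inl ⟨hp, hQ.iterate p, fun u => ?_⟩
    obtain ⟨r, hr⟩ := (NearId.exists_iterate_sub (Or.inl ⟨hp, hQ, hid⟩) u).2
    rw [hr]
    exact (hid u).mul_right _
  · subst hp
    refine Or.inr ⟨rfl, fun u => e u + e (S u), he.add (he.comp ?_), fun u => ?_⟩
    · rw [show S = fun u => u + 4 * e u from funext hS]
      exact DvdLip.id.add ((DvdLip.const _).mul he)
    · change S (S u) = _
      linear_combination hS (S u) + hS u

theorem norm_one_add_prime_mul (r : ℤ_[p]) : ‖1 + (p : ℤ_[p]) * r‖ = 1 := by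
  have h : ‖(p : ℤ_[p]) * r‖ < 1 := (PadicInt.norm_lt_one_iff_dvd _).mpr (dvd_mul_right _ _)
  have := PadicInt.norm_add_eq_max_of_ne (q := (1 : ℤ_[p])) (r := (p : ℤ_[p]) * r)
    (by rw [norm_one]; exact h.ne')
  rw [this, norm_one, max_eq_left h.le]

/-- Strong induction on `n`, with `S` varying: a factor `p` of `n` is absorbed by replacing `S` with
`S^p`, which is again close to the identity. -/
theorem NearId.norm_iterate_sub {S : ℤ_[p] → ℤ_[p]} (hS : NearId S) (n : ℕ) (u : ℤ_[p]) :
    ‖S^[n] u - u‖ = ‖(n : ℤ_[p])‖ * ‖S u - u‖ := by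
  induction n using Nat.strong_induction_on generalizing S with
  | _ n ih =>
    rcases Nat.eq_zero_or_pos n with rfl | hn
    · simp
    by_cases hpn : p ∣ n
    · obtain ⟨m, rfl⟩ := hpn
      have hm : m < p * m :=
        lt_mul_of_one_lt_left (Nat.pos_of_mul_pos_left hn) (Fact.out : p.Prime).one_lt
      rw [Function.iterate_mul, ih m hm hS.iterate_prime]
      obtain ⟨r, hr⟩ := (hS.exists_iterate_sub u).2
      rw [hr, norm_mul, norm_mul, norm_one_add_prime_mul, Nat.cast_mul, norm_mul]
      ring
    · obtain ⟨r, hr⟩ := (hS.exists_iterate_sub u).1 n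
      have hn1 : ‖(n : ℤ_[p])‖ = 1 := by
        by_contra hne
        have h1 : ‖(n : ℤ_[p])‖ < 1 := lt_of_le_of_ne (PadicInt.norm_le_one _) hne
        have h2 : ‖((n : ℤ) : ℤ_[p])‖ < 1 := by exact_mod_cast h1
        rw [PadicInt.norm_int_lt_one_iff_dvd] at h2
        exact hpn (by exact_mod_cast h2)
      have h : ‖(p : ℤ_[p]) * r‖ < 1 := (PadicInt.norm_lt_one_iff_dvd _).mpr (dvd_mul_right _ _)
      have h2 : ‖(n : ℤ_[p]) + p * r‖ = 1 := by
        rw [PadicInt.norm_add_eq_max_of_ne (by rw [hn1]; exact h.ne'), hn1, max_eq_left h.le]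
      rw [hr, norm_mul, h2, hn1, mul_comm]

theorem NearId.eq_of_iterate_eq {S : ℤ_[p] → ℤ_[p]} (hS : NearId S) {n : ℕ} (hn : n ≠ 0)
    {u : ℤ_[p]} (h : S^[n] u = u) : S u = u := by
  have h1 := hS.norm_iterate_sub n u
  rw [h, sub_self, norm_zero, eq_comm, mul_eq_zero, norm_eq_zero, norm_eq_zero] at h1
  exact sub_eq_zero.mp (h1.resolve_left (by exact_mod_cast hn))

/-! ### Reduction modulo `p`: affine maps of `𝔽_p` -/

theorem toZMod_eq_iff_dvd {x y : ℤ_[p]} :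
    PadicInt.toZMod x = PadicInt.toZMod y ↔ (p : ℤ_[p]) ∣ x - y := by
  rw [← sub_eq_zero, ← map_sub, ← RingHom.mem_ker, PadicInt.ker_toZMod,
    PadicInt.maximalIdeal_eq_span_p, Ideal.mem_span_singleton]

theorem toZMod_eq_zero_iff_dvd {x : ℤ_[p]} : PadicInt.toZMod x = 0 ↔ (p : ℤ_[p]) ∣ x := by
  simpa using toZMod_eq_iff_dvd (x := x) (y := 0)

theorem toZMod_iterate {T : ℤ_[p] → ℤ_[p]} {c l : ZMod p}
    (h : ∀ u, PadicInt.toZMod (T u) = c + l * PadicInt.toZMod u) (n : ℕ) (u : ℤ_[p]) :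
    PadicInt.toZMod (T^[n] u) = (fun x => c + l * x)^[n] (PadicInt.toZMod u) := by
  induction n with
  | zero => rfl
  | succ n ih => rw [Function.iterate_succ_apply', Function.iterate_succ_apply', h, ih]

theorem affine_one_iterate {R : Type*} [CommRing R] (c x : R) (n : ℕ) :
    (fun x => c + 1 * x)^[n] x = x + n * c := by
  induction n with
  | zero => simp
  | succ n ih => rw [Function.iterate_succ_apply', ih]; push_cast; ring

theorem affine_iterate {K : Type*} [Field K] {c l : K} (hl : l ≠ 1) (x : K) (n : ℕ) :
    (fun x => c + l * x)^[n] x = c / (1 - l) + l ^ n * (x - c / (1 - l)) := by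
  have h1 : 1 - l ≠ 0 := sub_ne_zero.mpr (Ne.symm hl)
  induction n with
  | zero => simp
  | succ n ih =>
    rw [Function.iterate_succ_apply', ih]
    field_simp
    ring

theorem IsQuadWith.toZMod {T : ℤ_[p] → ℤ_[p]} {l : ℤ_[p]} (hT : IsQuadWith l T) :
    ∃ c, ∀ u, PadicInt.toZMod (T u) = c + PadicInt.toZMod l * PadicInt.toZMod u := by
  obtain ⟨c, a, e, -, h⟩ := hT
  refine ⟨PadicInt.toZMod c, fun u => ?_⟩
  rw [h u]
  simp

/-- Modulo `p` the map is a homothety of ratio `l` about the fixed point `c / (1 - l)`, and `l^(p-1)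
= 1`. -/
theorem IsQuadWith.nearId_iterate_of_ne_one (hp : p ≠ 2) {T : ℤ_[p] → ℤ_[p]} {l : ℤ_[p]}
    (hT : IsQuadWith l T) (hl0 : PadicInt.toZMod l ≠ 0) (hl : PadicInt.toZMod l ≠ 1) :
    NearId T^[p - 1] := by
  obtain ⟨c, hc⟩ := hT.toZMod
  refine Or.inl ⟨hp, IsQuad.iterate ⟨l, hT⟩ _, fun u => ?_⟩
  rw [← toZMod_eq_iff_dvd, toZMod_iterate hc, affine_iterate hl, ZMod.pow_card_sub_one_eq_one hl0]
  ring

/-- Modulo `p` the map is a translation, whose order divides `p`. -/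
theorem IsQuadWith.nearId_iterate_of_eq_one (hp : p ≠ 2) {T : ℤ_[p] → ℤ_[p]} {l : ℤ_[p]}
    (hT : IsQuadWith l T) (hl : PadicInt.toZMod l = 1) : NearId T^[p] := by
  obtain ⟨c, hc⟩ := hT.toZMod
  refine Or.inl ⟨hp, IsQuad.iterate ⟨l, hT⟩ _, fun u => ?_⟩
  rw [hl] at hc
  rw [← toZMod_eq_iff_dvd, toZMod_iterate hc, affine_one_iterate]
  simp

theorem zmod_sum_range_affine {c : ZMod p} (hc : c ≠ 0) (u : ZMod p) {M : Type*}
    [AddCommMonoid M] (g : ZMod p → M) :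
    ∑ j ∈ Finset.range p, g (u + j * c) = ∑ x, g x := by
  refine Finset.sum_nbij' (fun j => u + j * c) (fun x => ((x - u) / c).val) ?_ ?_ ?_ ?_ ?_
  · simp
  · intro x _
    exact Finset.mem_range.mpr (ZMod.val_lt _)
  · intro j hj
    rw [add_sub_cancel_left, mul_div_cancel_right₀ _ hc, ZMod.val_cast_of_lt (Finset.mem_range.mp hj)]
  · intro x _
    rw [ZMod.natCast_zmod_val]
    field_simp
    ring
  · simp

/-- For `p ≥ 5`, a quadratic map that is a nontrivial translation modulo `p` has no point of
period `p`. -/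
theorem IsQuadWith.iterate_prime_ne (hp : 5 ≤ p) {T : ℤ_[p] → ℤ_[p]} {l : ℤ_[p]}
    (hT : IsQuadWith l T) (hl : PadicInt.toZMod l = 1) {u : ℤ_[p]}
    (hu : ¬ (p : ℤ_[p]) ∣ T u - u) : T^[p] u ≠ u := by
  have hp0 : (p : ℤ_[p]) ≠ 0 := by exact_mod_cast (Fact.out : p.Prime).ne_zero
  obtain ⟨c, a, e, he, h⟩ := hT
  have hc : ∀ u, PadicInt.toZMod (T u) = PadicInt.toZMod c + 1 * PadicInt.toZMod u := by
    intro u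
    rw [h u]
    simp [hl]
  have hc0 : PadicInt.toZMod c ≠ 0 := by
    intro h0
    rw [← toZMod_eq_iff_dvd, hc, h0] at hu
    simp at hu
  obtain ⟨m, hm⟩ : (p : ℤ_[p]) ∣ l - 1 := by
    rw [← toZMod_eq_iff_dvd, hl, map_one]
  have key : ∀ n : ℕ, T^[n] u - u = n * c + p * ∑ j ∈ Finset.range n,
      (m * T^[j] u + a * T^[j] u ^ 2 + p * e (T^[j] u)) := by
    intro n
    induction n with
    | zero => simp
    | succ n ih =>
      rw [Function.iterate_succ_apply', Finset.sum_range_succ, h (T^[n] u)]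
      push_cast
      linear_combination ih + T^[n] u * hm
  intro hfix
  have hk := key p
  -- A point of period `p` would give, after division by `p`, `c + ∑ (m x + a x²) = 0` in `𝔽_p`, the
  -- orbit running once through all residues.
  rw [hfix, sub_self, ← mul_add, eq_comm, mul_eq_zero] at hk
  have hk := congrArg PadicInt.toZMod (hk.resolve_left hp0)
  rw [map_zero, map_add, map_sum] at hk
  have : ∀ j ∈ Finset.range p, PadicInt.toZMod (m * T^[j] u + a * T^[j] u ^ 2 + (p : ℤ_[p]) * e (T^[j] u)) =
      (fun x => PadicInt.toZMod m * x + PadicInt.toZMod a * x ^ 2)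
        (PadicInt.toZMod u + j * PadicInt.toZMod c) := by
    intro j _
    rw [← affine_one_iterate (PadicInt.toZMod c), ← toZMod_iterate hc]
    simp
  rw [Finset.sum_congr rfl this, zmod_sum_range_affine hc0 (PadicInt.toZMod u)
    (fun x => PadicInt.toZMod m * x + PadicInt.toZMod a * x ^ 2), Finset.sum_add_distrib,
    ← Finset.mul_sum, ← Finset.mul_sum] at hk
  have s1 := FiniteField.sum_pow_lt_card_sub_one (ZMod p) 1 (by rw [ZMod.card]; omega)
  -- The exponent must be below `p - 1`; for `p = 3` the sum of the squares is not zero.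
  have s2 := FiniteField.sum_pow_lt_card_sub_one (ZMod p) 2 (by rw [ZMod.card]; omega)
  simp only [pow_one] at s1
  rw [s1, s2] at hk
  simp at hk
  exact hc0 hk

/-- With `l = 1 + 2m`, the linear coefficient of `T²` is 1 modulo 4 and the quadratic one, `2 a l (1
+ l)`, is 0 modulo 4: so `T²` is a translation modulo 4. -/
theorem IsQuadWith.two_iterate_two {T : ℤ_[2] → ℤ_[2]} {l : ℤ_[2]} (hT : IsQuadWith l T)
    (hl : ¬ (2 : ℤ_[2]) ∣ l) : ∃ (k : ℤ_[2]) (e : ℤ_[2] → ℤ_[2]), DvdLip e ∧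
      ∀ u, T^[2] u = u + 2 * k + 4 * e u := by
  have hT' : DvdLip T := IsQuad.dvdLip ⟨l, hT⟩
  obtain ⟨c, a, e, he, h⟩ := hT
  obtain ⟨m, hm⟩ : (2 : ℤ_[2]) ∣ l - 1 := by
    have h2 := toZMod_eq_iff_dvd (x := l) (y := 1)
    have h3 := toZMod_eq_zero_iff_dvd (x := l)
    push_cast at h2 h3
    rw [← h2, map_one]
    rw [← h3] at hl
    revert hl
    generalize PadicInt.toZMod l = z
    revert z
    decide
  obtain rfl : l = 1 + 2 * m := by linear_combination hm
  push_cast at h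
  refine ⟨c * (1 + m) + a * c ^ 2, fun u => (m + m ^ 2 + a * c * (1 + 2 * m)) * u +
    (1 + 2 * m) * a * (1 + m) * u ^ 2 + ((1 + 2 * m) * e u + a * (2 * ((c + (1 + 2 * m) * u) * (a * u ^ 2))
      + 2 * (a * u ^ 2) ^ 2 + 4 * ((c + (1 + 2 * m) * u) * e u) + 8 * ((a * u ^ 2) * e u)
      + 8 * e u ^ 2) + e (T u)), ?_, fun u => ?_⟩
  · have hA : DvdLip fun u : ℤ_[2] => c + (1 + 2 * m) * u :=
      (DvdLip.const c).add ((DvdLip.const _).mul .id)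
    have hB : DvdLip fun u : ℤ_[2] => a * u ^ 2 := (DvdLip.const a).mul (DvdLip.id.pow 2)
    refine (((DvdLip.const _).mul .id).add ((DvdLip.const _).mul (DvdLip.id.pow 2))).add
      ((((DvdLip.const _).mul he).add ((DvdLip.const _).mul ?_)).add (he.comp hT'))
    exact (((((DvdLip.const 2).mul (hA.mul hB)).add ((DvdLip.const _).mul (hB.pow 2))).add
      ((DvdLip.const _).mul (hA.mul he))).add ((DvdLip.const _).mul (hB.mul he))).add
      ((DvdLip.const _).mul (he.pow 2))
  · change T (T u) = _
    beta_reduce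
    rw [h (T u)]
    generalize e (T u) = E
    rw [h u]
    ring

/-- Composing the translation with itself doubles `2k`. The two error values differ by a multiple of
`T² u - u`, which is even, so their sum is even; hence `T^4` has no fixed point when `k` is odd. -/
theorem two_iterate_four {T : ℤ_[2] → ℤ_[2]} {k : ℤ_[2]} {e : ℤ_[2] → ℤ_[2]} (he : DvdLip e)
    (h : ∀ u, T^[2] u = u + 2 * k + 4 * e u) :
    NearId T^[4] ∧ ∀ u, ∃ r, T^[4] u - u = 4 * (k + 2 * r) := by
  have h4 : ∀ u, T^[4] u = u + 4 * (k + e u + e (T^[2] u)) := fun u => by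
    change T^[2] (T^[2] u) = _
    linear_combination h (T^[2] u) + h u
  have h2 : DvdLip T^[2] := by
    rw [show T^[2] = fun u => u + 2 * k + 4 * e u from funext h]
    exact (DvdLip.id.add (DvdLip.const _)).add ((DvdLip.const _).mul he)
  refine ⟨Or.inr ⟨rfl, _, ((DvdLip.const k).add he).add (he.comp h2), h4⟩, fun u => ?_⟩
  obtain ⟨r, hr⟩ := he (T^[2] u) u
  refine ⟨e u + (k + 2 * e u) * r, ?_⟩
  linear_combination h4 u + 4 * hr + 4 * r * h u

/-! ### Contraction or near-identity, and the possible periods -/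

/-- A quadratic map of `ℤ_p` is a contraction or has an iterate close to the identity. -/
theorem IsQuad.contracts_or_nearId {T : ℤ_[p] → ℤ_[p]} (hT : IsQuad T) :
    (∀ u v, (p : ℤ_[p]) * (u - v) ∣ T u - T v) ∨ ∃ n, n ≠ 0 ∧ NearId T^[n] := by
  obtain ⟨l, hl⟩ := hT
  by_cases hpl : (p : ℤ_[p]) ∣ l
  · exact Or.inl (hl.contracts hpl)
  refine Or.inr ?_
  have hpp : p.Prime := Fact.out
  by_cases hp : p = 2
  · subst hp
    obtain ⟨k, e, he, h⟩ := hl.two_iterate_two (by exact_mod_cast hpl)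
    exact ⟨4, by norm_num, (two_iterate_four he h).1⟩
  · rw [← toZMod_eq_zero_iff_dvd] at hpl
    by_cases h1 : PadicInt.toZMod l = 1
    · exact ⟨p, hpp.ne_zero, hl.nearId_iterate_of_eq_one hp h1⟩
    · exact ⟨p - 1, by have := hpp.two_le; omega, hl.nearId_iterate_of_ne_one hp hpl h1⟩

/-- A near-identity iterate has no periodic points except fixed ones, so `u` is already fixed by the
iterate that the multiplier dictates. -/
theorem IsQuad.period {T : ℤ_[p] → ℤ_[p]} (hT : IsQuad T) {n : ℕ} (hn : n ≠ 0) {u : ℤ_[p]}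
    (hu : T^[n] u = u) :
    T u = u ∨ T^[p - 1] u = u ∨ ((p = 2 ∨ p = 3) ∧ T^[p] u = u) := by
  have hpp : p.Prime := Fact.out
  have hu' : ∀ m, (T^[m])^[n] u = u := fun m => by
    rw [← Function.iterate_mul, mul_comm, Function.iterate_mul]
    exact Function.iterate_fixed hu m
  obtain ⟨l, hl⟩ := hT
  by_cases hpl : (p : ℤ_[p]) ∣ l
  · left
    have key : ∀ m : ℕ, (p : ℤ_[p]) ^ m * (T u - u) ∣ T^[m] (T u) - T^[m] u := by
      intro m
      induction m with
      | zero => simp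
      | succ m ih =>
        rw [Function.iterate_succ_apply', Function.iterate_succ_apply', pow_succ', mul_assoc]
        exact (mul_dvd_mul_left _ ih).trans (hl.contracts hpl _ _)
    -- Since `T^n` fixes both `u` and `T u`, their difference is divisible by `p^n` times itself,
    -- hence zero.
    have h1 := key n
    rw [(Function.Commute.iterate_self T n).eq, hu] at h1
    by_contra hne
    have hne' : T u - u ≠ 0 := sub_ne_zero.mpr hne
    obtain ⟨r, hr⟩ := h1
    have h2 : (p : ℤ_[p]) ^ n * r = 1 := by
      apply mul_left_cancel₀ hne'
      linear_combination -hr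
    have h3 : (p : ℤ_[p]) ∣ 1 := (dvd_pow_self _ hn).trans ⟨r, h2.symm⟩
    have h4 := (PadicInt.norm_lt_one_iff_dvd _).mpr h3
    simp at h4
  by_cases hp : p = 2
  · subst hp
    obtain ⟨k, e, he, h⟩ := hl.two_iterate_two (by exact_mod_cast hpl)
    refine Or.inr (Or.inr ⟨Or.inl rfl, ?_⟩)
    by_cases hk : (2 : ℤ_[2]) ∣ k
    · obtain ⟨k', rfl⟩ := hk
      have : NearId T^[2] := Or.inr ⟨rfl, fun u => k' + e u, (DvdLip.const k').add he,
        fun u => by rw [h u]; ring⟩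
      exact this.eq_of_iterate_eq hn (hu' 2)
    · obtain ⟨h4, h5⟩ := two_iterate_four he h
      obtain ⟨r, hr⟩ := h5 u
      rw [h4.eq_of_iterate_eq hn (hu' 4), sub_self, eq_comm, mul_eq_zero] at hr
      have hr := hr.resolve_left (by norm_num)
      exact absurd ⟨-r, by linear_combination hr⟩ hk
  · rw [← toZMod_eq_zero_iff_dvd] at hpl
    by_cases h1 : PadicInt.toZMod l = 1
    · have hfix := (hl.nearId_iterate_of_eq_one hp h1).eq_of_iterate_eq hn (hu' p)
      by_cases h3 : p = 3
      · exact Or.inr (Or.inr ⟨Or.inr h3, hfix⟩)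
      left
      have h5 : 5 ≤ p := by
        have h2 := hpp.two_le
        have h4 : p ≠ 4 := by rintro rfl; exact absurd hpp (by norm_num)
        omega
      have hdvd : (p : ℤ_[p]) ∣ T u - u := by
        by_contra hnd
        exact hl.iterate_prime_ne h5 h1 hnd hfix
      -- The displacement modulo `p` is the same at all points, so it vanishes everywhere once it
      -- vanishes at `u`.
      have : NearId T := by
        refine Or.inl ⟨hp, ⟨l, hl⟩, fun v => ?_⟩
        obtain ⟨c, hc⟩ := hl.toZMod
        rw [← toZMod_eq_iff_dvd, hc, h1, one_mul, add_eq_right] at hdvd ⊢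
        exact hdvd
      exact this.eq_of_iterate_eq hn hu
    · exact Or.inr (Or.inl ((hl.nearId_iterate_of_ne_one hp hpl h1).eq_of_iterate_eq hn
        (hu' (p - 1))))


/-! ### Integral homogeneous coordinates -/

theorem vec_ne_zero_of_isCoprime {x y : ℤ_[p]} (h : IsCoprime x y) :
    (![(x : ℚ_[p]), (y : ℚ_[p])] : Fin 2 → ℚ_[p]) ≠ 0 := by
  intro h0
  have hx : (x : ℚ_[p]) = 0 := congrFun h0 0
  have hy : (y : ℚ_[p]) = 0 := congrFun h0 1
  rw [PadicInt.coe_eq_zero] at hx hy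
  rw [hx, hy] at h
  exact not_isCoprime_zero_zero h

/-- The point `[x : y]` for coprime `p`-adic integers `x` and `y`. -/
noncomputable def toP1 (x y : ℤ_[p]) (h : IsCoprime x y) : P1 p :=
  Projectivization.mk ℚ_[p] ![(x : ℚ_[p]), (y : ℚ_[p])] (vec_ne_zero_of_isCoprime h)

theorem not_prime_dvd_one : ¬ (p : ℤ_[p]) ∣ 1 := fun h => by
  have := (PadicInt.norm_lt_one_iff_dvd _).mpr h
  simp at this

theorem max_norm_eq_one_of_isCoprime {x y : ℤ_[p]} (h : IsCoprime x y) : max ‖x‖ ‖y‖ = 1 := by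
  refine le_antisymm (max_le (PadicInt.norm_le_one _) (PadicInt.norm_le_one _)) ?_
  by_contra hlt
  rw [not_le, max_lt_iff, PadicInt.norm_lt_one_iff_dvd, PadicInt.norm_lt_one_iff_dvd] at hlt
  obtain ⟨a, b, hab⟩ := h
  exact not_prime_dvd_one (hab ▸ dvd_add (hlt.1.mul_left _) (hlt.2.mul_left _))

theorem dist_toP1 {x y x' y' : ℤ_[p]} (h : IsCoprime x y) (h' : IsCoprime x' y') :
    dist (toP1 x y h) (toP1 x' y' h') = ‖x * y' - x' * y‖ := by
  change sphDist p _ _ = _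
  rw [toP1, toP1, sphDist_mk, sphVec]
  have h1 : ‖((x * y' - x' * y : ℤ_[p]) : ℚ_[p])‖ = ‖x * y' - x' * y‖ := rfl
  have h2 : max ‖(x : ℚ_[p])‖ ‖(y : ℚ_[p])‖ = 1 := max_norm_eq_one_of_isCoprime h
  have h3 : max ‖(x' : ℚ_[p])‖ ‖(y' : ℚ_[p])‖ = 1 := max_norm_eq_one_of_isCoprime h'
  rw [← h1]
  change ‖(x : ℚ_[p]) * y' - x' * y‖ / (max ‖(x : ℚ_[p])‖ ‖(y : ℚ_[p])‖ *
    max ‖(x' : ℚ_[p])‖ ‖(y' : ℚ_[p])‖) = _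
  rw [h2, h3, mul_one, div_one]
  push_cast
  rfl

theorem toP1_eq_of_smul {x y x' y' t : ℤ_[p]} (h : IsCoprime x y) (h' : IsCoprime x' y')
    (hx : x = t * x') (hy : y = t * y') : toP1 x y h = toP1 x' y' h' := by
  rw [← dist_eq_zero, dist_toP1, hx, hy]
  rw [show t * x' * y' - x' * (t * y') = 0 by ring, norm_zero]

theorem exists_eq_toP1 (P : P1 p) :
    (∃ z : ℤ_[p], P = toP1 z 1 isCoprime_one_right) ∨
      ∃ b : ℤ_[p], P = toP1 1 ((p : ℤ_[p]) * b) isCoprime_one_left := by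
  have hv := P.rep_nonzero
  obtain ⟨v, hvP⟩ : ∃ v, v = P.rep := ⟨_, rfl⟩
  rw [← hvP] at hv
  have hP : P = Projectivization.mk ℚ_[p] v hv := by
    simp only [hvP, Projectivization.mk_rep]
  have key : ∀ i j : Fin 2, v i ≠ 0 → ‖v j‖ ≤ ‖v i‖ → ‖v j / v i‖ ≤ 1 := fun i j h0 h => by
    rw [norm_div]
    exact div_le_one_of_le₀ h (norm_nonneg _)
  rcases le_or_gt ‖v 0‖ ‖v 1‖ with h | h
  · left
    have h1 : v 1 ≠ 0 := by
      intro h1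
      rw [h1, norm_zero, norm_le_zero_iff] at h
      exact hv (by funext i; fin_cases i <;> assumption)
    refine ⟨⟨v 0 / v 1, key 1 0 h1 h⟩, ?_⟩
    rw [hP]
    unfold toP1
    rw [Projectivization.mk_eq_mk_iff']
    refine ⟨v 1, ?_⟩
    funext i
    fin_cases i
    · simp [mul_div_cancel₀ _ h1]
    · simp
  · right
    have h0 : v 0 ≠ 0 := by
      intro h0
      rw [h0, norm_zero] at h
      exact absurd h (not_lt.mpr (norm_nonneg _))
    set z : ℤ_[p] := ⟨v 1 / v 0, key 0 1 h0 h.le⟩ with hz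
    have hz1 : ‖z‖ < 1 := by
      change ‖v 1 / v 0‖ < 1
      rw [norm_div, div_lt_one (norm_pos_iff.mpr h0)]
      exact h
    obtain ⟨b, hb⟩ := (PadicInt.norm_lt_one_iff_dvd _).mp hz1
    refine ⟨b, ?_⟩
    rw [hP, toP1, Projectivization.mk_eq_mk_iff', ← hb]
    refine ⟨v 0, ?_⟩
    funext i
    fin_cases i
    · simp
    · simp [hz, mul_div_cancel₀ _ h0]

theorem exists_eq_toP1_of_isCoprime (P : P1 p) :
    ∃ (x y : ℤ_[p]) (h : IsCoprime x y), P = toP1 x y h := by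
  rcases exists_eq_toP1 P with ⟨z, hz⟩ | ⟨b, hb⟩
  · exact ⟨_, _, _, hz⟩
  · exact ⟨_, _, _, hb⟩

instance : IsUltrametricDist (P1 p) :=
  ⟨fun P Q R => sphVec_triangle p P.rep_nonzero Q.rep_nonzero R.rep_nonzero⟩

theorem dist_le_one (P Q : P1 p) : dist P Q ≤ 1 := by
  obtain ⟨x, y, h, rfl⟩ := exists_eq_toP1_of_isCoprime P
  obtain ⟨x', y', h', rfl⟩ := exists_eq_toP1_of_isCoprime Q
  rw [dist_toP1]
  exact PadicInt.norm_le_one _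

/-- The line is covered by two isometric copies of `ℤ_p`, around `0` and around `∞`. -/
instance : CompactSpace (P1 p) := by
  have h1 : Isometry fun z : ℤ_[p] => toP1 z 1 isCoprime_one_right :=
    Isometry.of_dist_eq fun z w => by rw [dist_toP1, dist_eq_norm]; simp
  have h2 : Isometry fun z : ℤ_[p] => toP1 1 z isCoprime_one_left :=
    Isometry.of_dist_eq fun z w => by rw [dist_toP1, dist_eq_norm, norm_sub_rev]; simp
  refine ⟨((isCompact_range h1.continuous).union (isCompact_range h2.continuous)).of_isClosed_subset
    isClosed_univ fun P _ => ?_⟩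
  rcases exists_eq_toP1 P with ⟨z, hz⟩ | ⟨b, hb⟩
  · exact Or.inl ⟨z, hz.symm⟩
  · exact Or.inr ⟨p * b, hb.symm⟩

/-- There are `p + 1` residue discs in the projective line. -/
theorem exists_residue :
    ∃ r : P1 p → Option (ZMod p), ∀ P Q, r P = r Q → dist P Q < 1 := by
  have key : ∀ P : P1 p, ∃ o : Option (ZMod p),
      (∃ z : ℤ_[p], P = toP1 z 1 isCoprime_one_right ∧ o = some (PadicInt.toZMod z)) ∨
      ∃ b : ℤ_[p], P = toP1 1 ((p : ℤ_[p]) * b) isCoprime_one_left ∧ o = none := by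
    intro P
    rcases exists_eq_toP1 P with ⟨z, hz⟩ | ⟨b, hb⟩
    · exact ⟨_, Or.inl ⟨z, hz, rfl⟩⟩
    · exact ⟨_, Or.inr ⟨b, hb, rfl⟩⟩
  choose r hr using key
  refine ⟨r, fun P Q h => ?_⟩
  rcases hr P with ⟨z, hz, hrz⟩ | ⟨z, hz, hrz⟩ <;> rcases hr Q with ⟨w, hw, hrw⟩ | ⟨w, hw, hrw⟩ <;>
    rw [hrz, hrw] at h
  · rw [hz, hw, dist_toP1, PadicInt.norm_lt_one_iff_dvd, mul_one, mul_one, ← toZMod_eq_iff_dvd]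
    exact Option.some_injective _ h
  · simp at h
  · simp at h
  · rw [hz, hw, dist_toP1, PadicInt.norm_lt_one_iff_dvd]
    exact ⟨w - z, by ring⟩

/-! ### Charts on residue discs -/

/-- A basis of `ℤ_p ^ 2` of determinant `1`, giving the parametrization `u ↦ [v + p u w]` of the
residue disc of `[v]`. -/
structure Chart (p : ℕ) [Fact p.Prime] where
  v₀ : ℤ_[p]
  v₁ : ℤ_[p]
  w₀ : ℤ_[p]
  w₁ : ℤ_[p]
  det : v₀ * w₁ - w₀ * v₁ = 1

namespace Chart

variable (C : Chart p)

theorem isCoprime (x : ℤ_[p]) : IsCoprime (C.v₀ + x * C.w₀) (C.v₁ + x * C.w₁) :=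
  ⟨C.w₁, -C.w₀, by linear_combination C.det⟩

/-- The parametrization `u ↦ [v + p u w]` of a residue disc. -/
noncomputable def pt (u : ℤ_[p]) : P1 p := toP1 _ _ (C.isCoprime (p * u))

theorem dist_pt (u u' : ℤ_[p]) : dist (C.pt u) (C.pt u') = ‖u - u'‖ / p := by
  rw [pt, pt, dist_toP1]
  have : (C.v₀ + p * u * C.w₀) * (C.v₁ + p * u' * C.w₁) -
      (C.v₀ + p * u' * C.w₀) * (C.v₁ + p * u * C.w₁) = p * (u' - u) := by
    linear_combination (p * (u' - u)) * C.det
  rw [this, norm_mul, PadicInt.norm_p, norm_sub_rev]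
  ring

theorem prime_cast_pos : (0 : ℝ) < p := by exact_mod_cast (Fact.out : p.Prime).pos

theorem norm_sub_eq (u u' : ℤ_[p]) : ‖u - u'‖ = p * dist (C.pt u) (C.pt u') := by
  have := prime_cast_pos (p := p)
  rw [dist_pt]
  field_simp

theorem pt_injective : Function.Injective C.pt := fun u u' h => by
  have := C.norm_sub_eq u u'
  rw [h, dist_self, mul_zero, norm_eq_zero] at this
  exact sub_eq_zero.mp this

theorem dist_pt_lt_one (u u' : ℤ_[p]) : dist (C.pt u) (C.pt u') < 1 := by
  have h1 : (1 : ℝ) < p := by exact_mod_cast (Fact.out : p.Prime).one_lt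
  rw [dist_pt, div_lt_one prime_cast_pos]
  exact (PadicInt.norm_le_one _).trans_lt h1

/-- The two determinants are the coordinates of `(x, y)` in the basis `v, w`; coprimality prevents
`p` from dividing both. -/
theorem isUnit_of_dvd {x y : ℤ_[p]} (h : IsCoprime x y)
    (hβ : (p : ℤ_[p]) ∣ C.v₀ * y - x * C.v₁) : IsUnit (x * C.w₁ - C.w₀ * y) := by
  rw [PadicInt.isUnit_iff]
  refine le_antisymm (PadicInt.norm_le_one _) ?_
  by_contra hlt
  rw [not_le, PadicInt.norm_lt_one_iff_dvd] at hlt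
  obtain ⟨a, b, hab⟩ := h
  refine not_prime_dvd_one (p := p) ?_
  have : (1 : ℤ_[p]) = (a * C.v₀ + b * C.v₁) * (x * C.w₁ - C.w₀ * y) +
      (a * C.w₀ + b * C.w₁) * (C.v₀ * y - x * C.v₁) := by
    linear_combination -hab - (a * x + b * y) * C.det
  rw [this]
  exact dvd_add (hlt.mul_left _) (hβ.mul_left _)

/-- In the basis `v, w` the point is `[α v + β w] = [v + (β/α) w]`, so its chart coordinate is `β /
(p α)`. -/
theorem toP1_eq_pt {x y : ℤ_[p]} (h : IsCoprime x y) {t : ℤ_[p]}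
    (ht : C.v₀ * y - x * C.v₁ = p * t * (x * C.w₁ - C.w₀ * y)) : toP1 x y h = C.pt t := by
  refine toP1_eq_of_smul (t := x * C.w₁ - C.w₀ * y) _ _ ?_ ?_
  · linear_combination C.w₀ * ht - x * C.det
  · linear_combination C.w₁ * ht - y * C.det

theorem dist_toP1_pt_zero {x y : ℤ_[p]} (h : IsCoprime x y) :
    dist (toP1 x y h) (C.pt 0) = ‖C.v₀ * y - x * C.v₁‖ := by
  rw [pt, dist_toP1, ← norm_neg]
  congr 1
  ring

theorem exists_eq_pt {P : P1 p} {u : ℤ_[p]} (h : dist P (C.pt u) < 1) : ∃ t, P = C.pt t := by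
  have h0 : dist P (C.pt 0) < 1 :=
    (dist_triangle_max P (C.pt u) (C.pt 0)).trans_lt (max_lt h (C.dist_pt_lt_one _ _))
  obtain ⟨x, y, hxy, rfl⟩ := exists_eq_toP1_of_isCoprime P
  rw [dist_toP1_pt_zero, PadicInt.norm_lt_one_iff_dvd] at h0
  obtain ⟨a, ha⟩ := (C.isUnit_of_dvd hxy h0).exists_left_inv
  obtain ⟨b, hb⟩ := h0
  exact ⟨b * a, C.toP1_eq_pt hxy (by linear_combination hb - p * b * ha)⟩

/-- A Bézout relation completes coprime coordinates to a basis of determinant 1. -/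
theorem exists_pt_zero_eq (P : P1 p) : ∃ C : Chart p, C.pt 0 = P := by
  obtain ⟨x, y, ⟨a, b, hab⟩, rfl⟩ := exists_eq_toP1_of_isCoprime P
  refine ⟨⟨x, y, -b, a, by linear_combination hab⟩, ?_⟩
  exact toP1_eq_of_smul (t := 1) _ _ (by simp) (by simp)

end Chart

/-- The line has no isolated points, so nonempty open sets are infinite; this keeps periodic points
out of minimal components. -/
instance (P : P1 p) : (𝓝[≠] P).NeBot := by
  obtain ⟨C, rfl⟩ := Chart.exists_pt_zero_eq P
  have hc : Continuous C.pt := by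
    refine (LipschitzWith.of_dist_le_mul (K := 1) fun u v => ?_).continuous
    rw [C.dist_pt, dist_eq_norm, NNReal.coe_one, one_mul]
    refine div_le_self (norm_nonneg _) ?_
    exact_mod_cast (Fact.out : p.Prime).one_lt.le
  refine mem_closure_iff_nhdsWithin_neBot.mp ?_
  refine mem_closure_of_tendsto (f := fun n : ℕ => C.pt ((p : ℤ_[p]) ^ n)) (b := Filter.atTop) ?_ ?_
  · refine (hc.tendsto 0).comp ?_
    rw [tendsto_zero_iff_norm_tendsto_zero]
    simp only [norm_pow, PadicInt.norm_p]
    refine tendsto_pow_atTop_nhds_zero_of_lt_one (by positivity) ?_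
    exact inv_lt_one_of_one_lt₀ (by exact_mod_cast (Fact.out : p.Prime).one_lt)
  · refine Filter.Eventually.of_forall fun n h => ?_
    have := C.pt_injective h
    exact pow_ne_zero n (by exact_mod_cast (Fact.out : p.Prime).ne_zero) this

/-! ### Maps with an integral lift -/

/-- The value at `(x, y)` of the degree `d` homogenization of `f`, over any commutative ring. -/
def homValue {R : Type*} [CommRing R] (d : ℕ) (f : R[X]) (x y : R) : R :=
  ∑ i ∈ Finset.range (d + 1), f.coeff i * x ^ i * y ^ (d - i)

/-- `φ` is given in homogeneous coordinates by two forms over `ℤ_p` which have no common zero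
modulo `p`. -/
def HasIntegralLift (φ : P1 p → P1 p) : Prop :=
  ∃ (d : ℕ) (f g : ℤ_[p][X]), ∀ (x y : ℤ_[p]) (h : IsCoprime x y),
    ∃ h' : IsCoprime (homValue d f x y) (homValue d g x y), φ (toP1 x y h) = toP1 _ _ h'

theorem exists_eval_eq_homValue {R : Type*} [CommRing R] (d : ℕ) (f : R[X]) (x y z w : R) :
    ∃ A : R[X], ∀ t, A.eval t = homValue d f (x + t * z) (y + t * w) := by
  refine ⟨∑ i ∈ Finset.range (d + 1), Polynomial.C (f.coeff i) *
    (Polynomial.C x + Polynomial.X * Polynomial.C z) ^ i *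
    (Polynomial.C y + Polynomial.X * Polynomial.C w) ^ (d - i), fun t => ?_⟩
  simp [homValue, Polynomial.eval_finsetSum, mul_comm t]

theorem exists_eval_prime_mul (P : ℤ_[p][X]) :
    ∃ (a b : ℤ_[p]) (e : ℤ_[p] → ℤ_[p]), DvdLip e ∧
      ∀ u, P.eval ((p : ℤ_[p]) * u) = P.eval 0 + p * a * u + p ^ 2 * b * u ^ 2 + p ^ 3 * e u := by
  have h : ∀ Q : ℤ_[p][X], ∀ t, Q.eval t = t * Q.divX.eval t + Q.coeff 0 := fun Q t => by
    conv_lhs => rw [← Q.X_mul_divX_add]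
    simp only [Polynomial.eval_add, Polynomial.eval_mul, Polynomial.eval_X, Polynomial.eval_C]
  refine ⟨P.divX.coeff 0, P.divX.divX.coeff 0, fun u => u ^ 3 * P.divX.divX.divX.eval ((p : ℤ_[p]) * u),
    (DvdLip.id.pow 3).mul ((DvdLip.eval _).comp ((DvdLip.const _).mul .id)), fun u => ?_⟩
  rw [h P (p * u), h P.divX (p * u), h P.divX.divX (p * u), Polynomial.coeff_zero_eq_eval_zero P]
  ring

/-- The map is `T = β(pu) / (p α(pu))`. Substituting `pu` gives the coefficient of `u^k` a factor
`p^k`; dividing by `p` leaves exactly the quadratic shape, once `1/α(pu)` is expanded to first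
order. -/
theorem isQuad_of_polynomials (α β : ℤ_[p][X]) (hα : IsUnit (α.eval 0))
    (hβ : (p : ℤ_[p]) ∣ β.eval 0) :
    ∃ T, IsQuad T ∧ ∀ u, β.eval ((p : ℤ_[p]) * u) = p * T u * α.eval ((p : ℤ_[p]) * u) := by
  obtain ⟨a₁, a₂, E, hE, hα'⟩ := exists_eval_prime_mul α
  obtain ⟨b₁, b₂, e, he, hβ'⟩ := exists_eval_prime_mul β
  obtain ⟨b₀, hb₀⟩ := hβ
  obtain ⟨i₀, hi₀⟩ := hα.exists_right_inv
  have hinv : ∀ u, ∃ i, α.eval ((p : ℤ_[p]) * u) * i = 1 := by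
    intro u
    refine IsUnit.exists_right_inv ?_
    rw [PadicInt.isUnit_iff, hα' u]
    have h1 : α.eval 0 + p * a₁ * u + p ^ 2 * a₂ * u ^ 2 + p ^ 3 * E u =
        α.eval 0 * (1 + p * (i₀ * (a₁ * u + p * a₂ * u ^ 2 + p ^ 2 * E u))) := by
      linear_combination -(p * (a₁ * u + p * a₂ * u ^ 2 + p ^ 2 * E u)) * hi₀
    rw [h1, norm_mul, norm_one_add_prime_mul, PadicInt.isUnit_iff.mp hα, one_mul]
  choose i hi using hinv
  have hiL : DvdLip i :=
    DvdLip.of_mul_eq_one ((DvdLip.eval α).comp ((DvdLip.const (p : ℤ_[p])).mul .id)) hi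
  set a₀ := α.eval 0
  set E' : ℤ_[p] → ℤ_[p] := fun u => a₂ * u ^ 2 + p * E u with hE'
  have hE'L : DvdLip E' :=
    ((DvdLip.const _).mul (DvdLip.id.pow 2)).add ((DvdLip.const _).mul hE)
  -- `ρ` measures the error of the first-order inverse: `(i₀ - p a₁ i₀² u) α(pu) = 1 + p² ρ(u)`.
  set ρ : ℤ_[p] → ℤ_[p] := fun u => i₀ * E' u - a₁ ^ 2 * i₀ ^ 2 * u ^ 2 -
    p * a₁ * i₀ ^ 2 * (u * E' u) with hρ
  have hρL : DvdLip ρ := (((DvdLip.const _).mul hE'L).sub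
    ((DvdLip.const _).mul (DvdLip.id.pow 2))).sub ((DvdLip.const _).mul (DvdLip.id.mul hE'L))
  have hiρ : ∀ u, i u = i₀ - p * a₁ * i₀ ^ 2 * u - p ^ 2 * (ρ u * i u) := by
    intro u
    have h1 := hi u
    rw [hα' u] at h1
    have h2 : (i₀ - p * a₁ * i₀ ^ 2 * u) *
        (a₀ + p * a₁ * u + p ^ 2 * a₂ * u ^ 2 + p ^ 3 * E u) = 1 + p ^ 2 * ρ u := by
      simp only [hρ, hE']
      linear_combination (1 - p * a₁ * i₀ * u) * hi₀
    linear_combination (i₀ - p * a₁ * i₀ ^ 2 * u) * h1 - i u * h2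
  set N : ℤ_[p] → ℤ_[p] := fun u => b₀ + b₁ * u + p * b₂ * u ^ 2 + p ^ 2 * e u with hN
  refine ⟨fun u => N u * i u, ⟨b₁ * i₀ - p * b₀ * a₁ * i₀ ^ 2, b₀ * i₀,
    b₂ * i₀ - b₁ * a₁ * i₀ ^ 2, fun u => e u * i u -
      (b₀ + b₁ * u + p * b₂ * u ^ 2) * (ρ u * i u) - b₂ * a₁ * i₀ ^ 2 * u ^ 3, ?_, fun u => ?_⟩,
    fun u => ?_⟩
  · refine ((he.mul hiL).sub (DvdLip.mul ?_ (hρL.mul hiL))).sub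
      ((DvdLip.const _).mul (DvdLip.id.pow 3))
    exact ((DvdLip.const b₀).add ((DvdLip.const b₁).mul .id)).add
      ((DvdLip.const _).mul (DvdLip.id.pow 2))
  · simp only [hN]
    linear_combination (b₀ + b₁ * u + p * b₂ * u ^ 2) * hiρ u
  · rw [hβ' u, hb₀]
    simp only [hN]
    linear_combination -(p * (b₀ + b₁ * u + p * b₂ * u ^ 2 + p ^ 2 * e u)) * hi u

/-- In charts, a map with an integral lift is quadratic. -/
theorem HasIntegralLift.exists_isQuad {φ : P1 p → P1 p} (hφ : HasIntegralLift φ) (C C' : Chart p)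
    (h : dist (φ (C.pt 0)) (C'.pt 0) < 1) :
    ∃ T, IsQuad T ∧ ∀ u, φ (C.pt u) = C'.pt (T u) := by
  obtain ⟨d, f, g, hφ⟩ := hφ
  obtain ⟨A, hA⟩ := exists_eval_eq_homValue d f C.v₀ C.v₁ C.w₀ C.w₁
  obtain ⟨B, hB⟩ := exists_eval_eq_homValue d g C.v₀ C.v₁ C.w₀ C.w₁
  have hcop : ∀ u, ∃ h : IsCoprime (A.eval ((p : ℤ_[p]) * u)) (B.eval ((p : ℤ_[p]) * u)),
      φ (C.pt u) = toP1 _ _ h := by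
    intro u
    obtain ⟨h', hh⟩ := hφ _ _ (C.isCoprime (p * u))
    refine ⟨by rw [hA, hB]; exact h', ?_⟩
    rw [Chart.pt, hh]
    exact toP1_eq_of_smul (t := 1) _ _ (by rw [hA, one_mul]) (by rw [hB, one_mul])
  set α : ℤ_[p][X] := A * Polynomial.C C'.w₁ - Polynomial.C C'.w₀ * B with hα
  set β : ℤ_[p][X] := Polynomial.C C'.v₀ * B - A * Polynomial.C C'.v₁ with hβ
  obtain ⟨h0, h0'⟩ := hcop 0
  rw [h0', C'.dist_toP1_pt_zero, PadicInt.norm_lt_one_iff_dvd] at h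
  have hβ0 : (p : ℤ_[p]) ∣ β.eval 0 := by simpa [hβ] using h
  have hα0 : IsUnit (α.eval 0) := by simpa [hα] using C'.isUnit_of_dvd h0 h
  obtain ⟨T, hT, hT'⟩ := isQuad_of_polynomials α β hα0 hβ0
  refine ⟨T, hT, fun u => ?_⟩
  obtain ⟨hu, hu'⟩ := hcop u
  rw [hu']
  exact C'.toP1_eq_pt hu (by simpa [hα, hβ] using hT' u)

theorem DvdLip.norm_sub_le {e : ℤ_[p] → ℤ_[p]} (he : DvdLip e) (u v : ℤ_[p]) :
    ‖e u - e v‖ ≤ ‖u - v‖ := by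
  obtain ⟨r, hr⟩ := he u v
  rw [hr, norm_mul]
  exact mul_le_of_le_one_right (norm_nonneg _) (PadicInt.norm_le_one _)

/-- Within a disc this is the chart form of the map; points of different discs are at the maximal
distance 1. -/
theorem HasIntegralLift.lipschitz {φ : P1 p → P1 p} (hφ : HasIntegralLift φ) :
    LipschitzWith 1 φ := by
  refine LipschitzWith.of_dist_le_mul fun P Q => ?_
  rw [NNReal.coe_one, one_mul]
  rcases lt_or_ge (dist Q P) 1 with h | h
  · obtain ⟨C, rfl⟩ := Chart.exists_pt_zero_eq P
    obtain ⟨C', hC'⟩ := Chart.exists_pt_zero_eq (φ (C.pt 0))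
    obtain ⟨T, hT, hT'⟩ := hφ.exists_isQuad C C' (by rw [hC', dist_self]; exact one_pos)
    obtain ⟨t, rfl⟩ := C.exists_eq_pt h
    rw [hT', hT', C.dist_pt, C'.dist_pt]
    exact div_le_div_of_nonneg_right (hT.dvdLip.norm_sub_le _ _) Chart.prime_cast_pos.le
  · rw [dist_comm P Q]
    exact (dist_le_one _ _).trans h

theorem HasIntegralLift.exists_isQuad_iterate {φ : P1 p → P1 p} (hφ : HasIntegralLift φ) (n : ℕ)
    (C C' : Chart p) (h : dist (φ^[n + 1] (C.pt 0)) (C'.pt 0) < 1) :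
    ∃ T, IsQuad T ∧ ∀ u, φ^[n + 1] (C.pt u) = C'.pt (T u) := by
  induction n generalizing C' with
  | zero => exact hφ.exists_isQuad C C' h
  | succ n ih =>
    obtain ⟨D, hD⟩ := Chart.exists_pt_zero_eq (φ^[n + 1] (C.pt 0))
    obtain ⟨T, hT, hT'⟩ := ih D (by rw [hD, dist_self]; exact one_pos)
    rw [Function.iterate_succ_apply', ← hD] at h
    obtain ⟨S, hS, hS'⟩ := hφ.exists_isQuad D C' h
    exact ⟨fun u => S (T u), hS.comp hT, fun u => by
      rw [Function.iterate_succ_apply', hT', hS']⟩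


/-! ### Orbits -/

section Orbit

variable {X : Type*} {φ : X → X}

theorem mapsTo_orbit (φ : X → X) (x : X) : Set.MapsTo φ (orbit φ x) (orbit φ x) := by
  rintro _ ⟨n, rfl⟩
  exact ⟨n + 1, Function.iterate_succ_apply' φ n x⟩

theorem orbit_subset_of_mapsTo {E : Set X} (hE : Set.MapsTo φ E E) {x : X} (hx : x ∈ E) :
    orbit φ x ⊆ E := by
  rintro _ ⟨n, rfl⟩
  exact hE.iterate n hx

theorem mem_orbit_self (φ : X → X) (x : X) : x ∈ orbit φ x := ⟨0, rfl⟩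

theorem orbit_finite_of_mem_periodicPts {x : X} (hx : x ∈ Function.periodicPts φ) :
    (orbit φ x).Finite := by
  refine (Set.finite_range fun n : Fin (Function.minimalPeriod φ x) => φ^[n] x).subset ?_
  rintro _ ⟨n, rfl⟩
  refine ⟨⟨n % Function.minimalPeriod φ x,
    Nat.mod_lt _ (Function.minimalPeriod_pos_of_mem_periodicPts hx)⟩, ?_⟩
  exact Function.iterate_mod_minimalPeriod_eq

end Orbit

/-! ### Recurrent orbits of `1`-Lipschitz maps -/

section Recurrent

variable {X : Type*} [MetricSpace X] {φ : X → X}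

/-- The orbit of `x` returns arbitrarily close to `x`, arbitrarily late. -/
def IsRecurrent (φ : X → X) (x : X) : Prop := ∀ ε > 0, ∀ m : ℕ, ∃ n ≥ m, dist (φ^[n] x) x < ε

theorem dist_iterate_le (hφ : LipschitzWith 1 φ) (n : ℕ) (a b : X) :
    dist (φ^[n] a) (φ^[n] b) ≤ dist a b := by
  simpa using (hφ.iterate n).dist_le_mul a b

/-- A distance that has shrunk cannot grow again under a 1-Lipschitz map, yet a late return brings
both points back near their initial positions. -/
theorem IsRecurrent.dist_iterate_eq (hφ : LipschitzWith 1 φ) {x : X} (hx : IsRecurrent φ x)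
    (i a b : ℕ) : dist (φ^[i] (φ^[a] x)) (φ^[i] (φ^[b] x)) = dist (φ^[a] x) (φ^[b] x) := by
  refine le_antisymm (dist_iterate_le hφ _ _ _) (le_of_forall_pos_le_add fun ε hε => ?_)
  obtain ⟨n, hn, hnx⟩ := hx (ε / 2) (by positivity) i
  have key : ∀ c, dist (φ^[n] (φ^[c] x)) (φ^[c] x) < ε / 2 := fun c => by
    rw [(Function.Commute.iterate_iterate_self φ n c).eq]
    exact (dist_iterate_le hφ _ _ _).trans_lt hnx
  have h1 : dist (φ^[n] (φ^[a] x)) (φ^[n] (φ^[b] x)) ≤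
      dist (φ^[i] (φ^[a] x)) (φ^[i] (φ^[b] x)) := by
    obtain ⟨k, rfl⟩ := Nat.exists_eq_add_of_le' hn
    rw [Function.iterate_add_apply φ k i, Function.iterate_add_apply φ k i]
    exact dist_iterate_le hφ _ _ _
  have h2 := dist_triangle4 (φ^[a] x) (φ^[n] (φ^[a] x)) (φ^[n] (φ^[b] x)) (φ^[b] x)
  have h3 := key a
  have h4 := key b
  rw [dist_comm] at h3
  linarith

theorem mapsTo_closure_orbit (hφ : Continuous φ) (x : X) :
    Set.MapsTo φ (closure (orbit φ x)) (closure (orbit φ x)) :=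
  (mapsTo_orbit φ x).closure hφ

/-- The orbit closure of a recurrent point of a `1`-Lipschitz map is minimal. -/
theorem IsRecurrent.isMinimalSubsystem (hφ : LipschitzWith 1 φ) {x : X} (hx : IsRecurrent φ x) :
    IsMinimalSubsystem φ (closure (orbit φ x)) := by
  refine ⟨mapsTo_closure_orbit hφ.continuous x, fun z hz => ?_⟩
  -- It suffices to recover `x` from `z`: if `z` is near `φ^m x` and `φ^n x` is near `x` with `n ≥
  -- m`, then `φ^(n-m) z` is near `x`.
  have hxz : x ∈ closure (orbit φ z) := by
    rw [Metric.mem_closure_iff] at hz ⊢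
    intro ε hε
    obtain ⟨_, ⟨m, rfl⟩, hm⟩ := hz (ε / 2) (by positivity)
    obtain ⟨n, hn, hnx⟩ := hx (ε / 2) (by positivity) m
    obtain ⟨k, rfl⟩ := Nat.exists_eq_add_of_le' hn
    refine ⟨φ^[k] z, ⟨k, rfl⟩, ?_⟩
    rw [Function.iterate_add_apply] at hnx
    have h1 := dist_iterate_le hφ k z (φ^[m] x)
    have h2 := dist_triangle x (φ^[k] (φ^[m] x)) (φ^[k] z)
    rw [dist_comm] at hnx
    rw [dist_comm (φ^[k] z)] at h1
    simp only at hm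
    linarith
  exact closure_minimal
    (orbit_subset_of_mapsTo (mapsTo_closure_orbit hφ.continuous z) hxz) isClosed_closure

theorem mem_basin_of_iterate {E : Set X} {x : X} (j : ℕ) (h : φ^[j] x ∈ basin φ E) :
    x ∈ basin φ E := by
  refine (Filter.tendsto_add_atTop_iff_nat j).mp ?_
  simpa only [basin, Set.mem_ofPred_eq, Function.iterate_add_apply] using h

theorem subset_basin_of_mapsTo {E : Set X} (hE : Set.MapsTo φ E E) : E ⊆ basin φ E := fun x hx => by
  refine tendsto_const_nhds.congr fun n => ?_
  exact (Metric.infDist_zero_of_mem (hE.iterate n hx)).symm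

/-- If a subsequence of the orbit of `x` converges to `y`, then `x` lies in the basin of the orbit
of `y`. -/
theorem mem_basin_orbit (hφ : LipschitzWith 1 φ) {x y : X}
    (h : ∀ ε > 0, ∃ n, dist (φ^[n] x) y < ε) : x ∈ basin φ (orbit φ y) := by
  refine Metric.tendsto_atTop.mpr fun ε hε => ?_
  obtain ⟨m, hm⟩ := h ε hε
  refine ⟨m, fun n hn => ?_⟩
  obtain ⟨k, rfl⟩ := Nat.exists_eq_add_of_le' hn
  rw [Real.dist_0_eq_abs, abs_of_nonneg Metric.infDist_nonneg, Function.iterate_add_apply]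
  exact (Metric.infDist_le_dist_of_mem (Set.mem_range_self k)).trans_lt
    ((dist_iterate_le hφ k _ _).trans_lt hm)

theorem IsMinimalComponent.eq_closure_orbit {E : Set X} (hE : IsMinimalComponent φ E) {x : X}
    (hx : x ∈ E) : E = closure (orbit φ x) :=
  (hE.2.2.2 x hx).antisymm (closure_minimal (orbit_subset_of_mapsTo hE.2.2.1 hx) hE.2.1.isClosed)

theorem pairwiseDisjoint_isMinimalComponent (φ : X → X) :
    {E | IsMinimalComponent φ E}.PairwiseDisjoint id := by
  intro E hE F hF hne
  refine Set.disjoint_left.mpr fun x hxE hxF => hne ?_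
  rw [IsMinimalComponent.eq_closure_orbit hE hxE, IsMinimalComponent.eq_closure_orbit hF hxF]

theorem IsMinimalComponent.disjoint_periodicPts [∀ x : X, (𝓝[≠] x).NeBot] {E : Set X}
    (hE : IsMinimalComponent φ E) : Disjoint (Function.periodicPts φ) E := by
  refine Set.disjoint_left.mpr fun x hx hxE => ?_
  have h1 : E.Infinite := infinite_of_mem_nhds x (hE.2.1.isOpen.mem_nhds hxE)
  rw [hE.eq_closure_orbit hxE, (orbit_finite_of_mem_periodicPts hx).isClosed.closure_eq] at h1
  exact h1 (orbit_finite_of_mem_periodicPts hx)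

end Recurrent

/-! ### Sequences that imitate the embedding of `ℕ` in `ℤ_p` -/

theorem dvd_of_norm_le {x y : ℤ_[p]} (h : ‖x‖ ≤ ‖y‖) : y ∣ x := by
  rcases eq_or_ne y 0 with rfl | hy
  · rw [norm_zero, norm_le_zero_iff] at h
    rw [h]
  · have hy' : (y : ℚ_[p]) ≠ 0 := fun h => hy (PadicInt.coe_eq_zero.mp h)
    refine ⟨⟨x / y, ?_⟩, ?_⟩
    · rw [norm_div]
      exact div_le_one_of_le₀ h (norm_nonneg _)
    · apply Subtype.ext
      change (x : ℚ_[p]) = y * (x / y)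
      rw [mul_div_cancel₀ _ hy']

/-- After normalization, `n ↦ a n` preserves `p`-adic distances, so it is injective from residues
modulo `p^t` to residues modulo `p^t`, hence surjective; every `w` in the ball is thus approximated.
-/
theorem mem_closure_range_of_norm_sub_eq {u : ℕ → ℤ_[p]} {δ : ℝ}
    (hu : ∀ n m : ℕ, ‖u n - u m‖ = ‖(n : ℤ_[p]) - m‖ * δ) {w : ℤ_[p]} (hw : ‖w - u 0‖ ≤ δ) :
    w ∈ closure (Set.range u) := by
  have hp1 : (1 : ℝ) < p := by exact_mod_cast (Fact.out : p.Prime).one_lt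
  set D := u 1 - u 0 with hD
  have hδ : δ = ‖D‖ := by rw [hD, hu 1 0]; simp
  rcases eq_or_ne D 0 with hD0 | hD0
  · rw [hδ, hD0, norm_zero, norm_le_zero_iff, sub_eq_zero] at hw
    exact subset_closure ⟨0, hw.symm⟩
  have hdvd : ∀ n, D ∣ u n - u 0 := fun n => dvd_of_norm_le (by
    rw [hu, hδ]
    exact mul_le_of_le_one_left (norm_nonneg _) (PadicInt.norm_le_one _))
  choose a ha using hdvd
  obtain ⟨b, hb⟩ := dvd_of_norm_le (hδ ▸ hw)
  have ha' : ∀ n m : ℕ, ‖a n - a m‖ = ‖(n : ℤ_[p]) - m‖ := fun n m => by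
    have h1 := hu n m
    rw [show u n - u m = (a n - a m) * D by linear_combination ha n - ha m, norm_mul, hδ] at h1
    exact mul_right_cancel₀ (norm_ne_zero_iff.mpr hD0) h1
  rw [Metric.mem_closure_range_iff]
  intro ε hε
  obtain ⟨t, ht⟩ := exists_pow_lt_of_lt_one hε (inv_lt_one_of_one_lt₀ hp1)
  have : NeZero (p ^ t) := ⟨pow_ne_zero _ (Fact.out : p.Prime).ne_zero⟩
  have hdvd_iff : ∀ x y : ℤ_[p], PadicInt.toZModPow t x = PadicInt.toZModPow t y ↔
      ‖x - y‖ ≤ (p : ℝ) ^ (-(t : ℤ)) := fun x y => by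
    rw [← sub_eq_zero, ← map_sub, ← RingHom.mem_ker, PadicInt.ker_toZModPow,
      PadicInt.norm_le_pow_iff_mem_span_pow]
  have hinj : Function.Injective fun j : ZMod (p ^ t) => PadicInt.toZModPow t (a j.val) := by
    intro i j hij
    have h1 := (hdvd_iff _ _).mp hij
    rw [ha', ← hdvd_iff] at h1
    simpa using h1
  obtain ⟨j, hj⟩ := Finite.injective_iff_surjective.mp hinj (PadicInt.toZModPow t b)
  refine ⟨j.val, ?_⟩
  have h2 := (hdvd_iff _ _).mp hj
  rw [dist_comm, dist_eq_norm, show u j.val - w = D * (a j.val - b) by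
    linear_combination ha j.val - hb, norm_mul]
  refine (mul_le_of_le_one_left (norm_nonneg _) (PadicInt.norm_le_one _)).trans_lt
    (h2.trans_lt ?_)
  rwa [zpow_neg, zpow_natCast, ← inv_pow]

theorem closedBall_subset_closure_range {x : ℕ → P1 p} {δ : ℝ} (hδ : δ < 1)
    (hx : ∀ n m : ℕ, dist (x n) (x m) = ‖(n : ℤ_[p]) - m‖ * δ) :
    Metric.closedBall (x 0) δ ⊆ closure (Set.range x) := by
  have hp := Chart.prime_cast_pos (p := p)
  have hδ0 : 0 ≤ δ := by
    have := hx 1 0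
    simp only [Nat.cast_one, Nat.cast_zero, sub_zero, norm_one, one_mul] at this
    rw [← this]
    exact dist_nonneg
  obtain ⟨C, hC⟩ := Chart.exists_pt_zero_eq (x 0)
  have hmem : ∀ n, ∃ u, x n = C.pt u := fun n => by
    refine C.exists_eq_pt (u := 0) ?_
    rw [hC, hx]
    exact (mul_le_of_le_one_left hδ0 (PadicInt.norm_le_one _)).trans_lt hδ
  choose u hu using hmem
  intro P hP
  rw [Metric.mem_closedBall] at hP
  obtain ⟨w, rfl⟩ := C.exists_eq_pt (u := 0) (hC ▸ hP.trans_lt hδ)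
  have hw : w ∈ closure (Set.range u) := by
    refine mem_closure_range_of_norm_sub_eq (δ := p * δ) (fun n m => ?_) ?_
    · rw [C.norm_sub_eq, ← hu, ← hu, hx]
      ring
    · rw [C.norm_sub_eq, ← hu]
      exact mul_le_mul_of_nonneg_left hP hp.le
  rw [Metric.mem_closure_range_iff] at hw ⊢
  intro ε hε
  obtain ⟨n, hn⟩ := hw (p * ε) (by positivity)
  refine ⟨n, ?_⟩
  rw [hu n, C.dist_pt, div_lt_iff₀ hp, mul_comm ε, ← dist_eq_norm]
  exact hn

/-- A point which moves under the iterates of `φ^N` like an integer under translation lies in a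
minimal component. -/
theorem isMinimalComponent_closure_orbit {φ : P1 p → P1 p} (hφ : LipschitzWith 1 φ) {N : ℕ}
    (hN : N ≠ 0) {x : P1 p} {δ : ℝ} (hδ0 : 0 < δ) (hδ1 : δ < 1)
    (hx : ∀ n : ℕ, dist (φ^[N * n] x) x = ‖(n : ℤ_[p])‖ * δ) :
    IsMinimalComponent φ (closure (orbit φ x)) := by
  have hp1 : (1 : ℝ) < p := by exact_mod_cast (Fact.out : p.Prime).one_lt
  have hrec : IsRecurrent φ x := by
    intro ε hε m
    obtain ⟨t, ht⟩ := exists_pow_lt_of_lt_one hε (inv_lt_one_of_one_lt₀ hp1)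
    -- The exponent `t` makes the return close, and `m` makes it late.
    refine ⟨N * p ^ (t + m), ?_, ?_⟩
    · have h1 : m ≤ p ^ (t + m) :=
        (Nat.lt_pow_self (Fact.out : p.Prime).one_lt).le.trans
          (Nat.pow_le_pow_right (Fact.out : p.Prime).pos (Nat.le_add_left m t))
      exact h1.trans (Nat.le_mul_of_pos_left _ (Nat.pos_of_ne_zero hN))
    · rw [hx]
      push_cast
      rw [norm_pow, PadicInt.norm_p, pow_add]
      have h1 : ((p : ℝ)⁻¹) ^ m ≤ 1 := pow_le_one₀ (by positivity) (inv_le_one_of_one_le₀ hp1.le)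
      have h2 : 0 < ((p : ℝ)⁻¹) ^ t := by positivity
      have h3 : 0 < ((p : ℝ)⁻¹) ^ m := by positivity
      calc ((p : ℝ)⁻¹) ^ t * ((p : ℝ)⁻¹) ^ m * δ ≤ ((p : ℝ)⁻¹) ^ t * 1 * 1 := by gcongr
        _ < ε := by simpa using ht
  have hdist_le : ∀ i n m : ℕ, m ≤ n →
      dist (φ^[N * n] (φ^[i] x)) (φ^[N * m] (φ^[i] x)) = ‖(n : ℤ_[p]) - m‖ * δ := by
    intro i n m hmn
    obtain ⟨k, rfl⟩ := Nat.exists_eq_add_of_le hmn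
    have e1 : φ^[N * (m + k)] (φ^[i] x) = φ^[N * m + i] (φ^[N * k] x) := by
      simp only [← Function.iterate_add_apply]
      congr 1
      ring
    have e2 : φ^[N * m] (φ^[i] x) = φ^[N * m + i] (φ^[0] x) := by
      rw [Function.iterate_add_apply]; rfl
    rw [e1, e2, hrec.dist_iterate_eq hφ, Function.iterate_zero, _root_.id, hx]
    push_cast
    rw [add_sub_cancel_left]
  have hdist : ∀ i n m : ℕ,
      dist (φ^[N * n] (φ^[i] x)) (φ^[N * m] (φ^[i] x)) = ‖(n : ℤ_[p]) - m‖ * δ := by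
    intro i n m
    rcases le_total m n with h | h
    · exact hdist_le i n m h
    · rw [dist_comm, norm_sub_rev]
      exact hdist_le i m n h
  -- The orbit splits into `N` classes modulo `N`, each dense in a ball of radius `δ`; such balls
  -- are open by ultrametricity, so the closure is clopen.
  have heq : closure (orbit φ x) = ⋃ i ∈ Finset.range N, Metric.closedBall (φ^[i] x) δ := by
    apply Set.Subset.antisymm
    · refine closure_minimal ?_ (isClosed_biUnion_finset fun i _ => Metric.isClosed_closedBall)
      rintro _ ⟨n, rfl⟩
      refine Set.mem_iUnion₂.mpr ⟨n % N, Finset.mem_range.mpr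
        (Nat.mod_lt _ (Nat.pos_of_ne_zero hN)), ?_⟩
      rw [Metric.mem_closedBall]
      have h1 := hdist (n % N) (n / N) 0
      rw [mul_zero, Function.iterate_zero, _root_.id, ← Function.iterate_add_apply,
        Nat.div_add_mod] at h1
      change dist (φ^[n] x) _ ≤ δ
      rw [h1]
      exact mul_le_of_le_one_left hδ0.le (PadicInt.norm_le_one _)
    · refine Set.iUnion₂_subset fun i _ => ?_
      have h1 := closedBall_subset_closure_range (x := fun n => φ^[N * n] (φ^[i] x)) hδ1 (hdist i)
      refine h1.trans (closure_mono ?_)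
      rintro _ ⟨n, rfl⟩
      exact ⟨N * n + i, Function.iterate_add_apply _ _ _ _⟩
  refine ⟨⟨x, subset_closure (mem_orbit_self φ x)⟩, ⟨isClosed_closure, ?_⟩,
    hrec.isMinimalSubsystem hφ⟩
  rw [heq]
  exact isOpen_biUnion fun i _ => IsUltrametricDist.isOpen_closedBall _ hδ0.ne'

/-! ### Dynamics of maps with an integral lift -/

theorem iterate_mul_pt {φ : P1 p → P1 p} {k : ℕ} {C : Chart p} {T : ℤ_[p] → ℤ_[p]}
    (hT : ∀ u, φ^[k] (C.pt u) = C.pt (T u)) (n : ℕ) (u : ℤ_[p]) :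
    φ^[k * n] (C.pt u) = C.pt (T^[n] u) := by
  rw [Function.iterate_mul]
  induction n with
  | zero => rfl
  | succ n ih => rw [Function.iterate_succ_apply', ih, hT, Function.iterate_succ_apply']

theorem exists_fixed_of_contracts {T : ℤ_[p] → ℤ_[p]}
    (hT : ∀ u v, (p : ℤ_[p]) * (u - v) ∣ T u - T v) :
    ∃ y, T y = y ∧ ∀ u, Filter.Tendsto (fun n => T^[n] u) Filter.atTop (𝓝 y) := by
  have hp1 : (1 : ℝ) < p := by exact_mod_cast (Fact.out : p.Prime).one_lt
  have hc : ContractingWith (p : NNReal)⁻¹ T := by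
    refine ⟨inv_lt_one_of_one_lt₀ (by exact_mod_cast hp1), LipschitzWith.of_dist_le_mul
      fun u v => ?_⟩
    obtain ⟨r, hr⟩ := hT u v
    rw [dist_eq_norm, dist_eq_norm, hr, norm_mul, norm_mul, PadicInt.norm_p, NNReal.coe_inv,
      NNReal.coe_natCast]
    exact mul_le_of_le_one_right (by positivity) (PadicInt.norm_le_one _)
  exact ⟨_, hc.fixedPoint_isFixedPt, hc.tendsto_iterate_fixedPoint⟩

/-- By pigeonhole the orbit meets some disc twice; from the first visit on, a power of `φ` acts on
that disc through a map `T` as above. -/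
theorem HasIntegralLift.exists_attractor {φ : P1 p → P1 p} (hφ : HasIntegralLift φ) (x : P1 p) :
    (∃ y ∈ Function.periodicPts φ, x ∈ basin φ (orbit φ y)) ∨
      ∃ E, IsMinimalComponent φ E ∧ x ∈ basin φ E := by
  have hp := Chart.prime_cast_pos (p := p)
  have hp1 : (1 : ℝ) < p := by exact_mod_cast (Fact.out : p.Prime).one_lt
  have hL := hφ.lipschitz
  obtain ⟨r, hr⟩ := exists_residue (p := p)
  obtain ⟨i, j, hij, hrij⟩ :
      ∃ i j : ℕ, i < j ∧ r (φ^[j] x) = r (φ^[i] x) := by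
    obtain ⟨i, j, hne, h⟩ := Finite.exists_ne_map_eq_of_infinite fun n : ℕ => r (φ^[n] x)
    rcases lt_or_gt_of_ne hne with h' | h'
    · exact ⟨i, j, h', h.symm⟩
    · exact ⟨j, i, h', h⟩
  obtain ⟨k, rfl⟩ := Nat.exists_eq_add_of_lt hij
  have hd := hr _ _ hrij
  rw [show i + k + 1 = (k + 1) + i by ring, Function.iterate_add_apply] at hd
  suffices (∃ y ∈ Function.periodicPts φ, φ^[i] x ∈ basin φ (orbit φ y)) ∨
      ∃ E, IsMinimalComponent φ E ∧ φ^[i] x ∈ basin φ E by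
    rcases this with ⟨y, hy, h⟩ | ⟨E, hE, h⟩
    · exact Or.inl ⟨y, hy, mem_basin_of_iterate i h⟩
    · exact Or.inr ⟨E, hE, mem_basin_of_iterate i h⟩
  generalize φ^[i] x = x' at hd
  obtain ⟨C, rfl⟩ := Chart.exists_pt_zero_eq x'
  obtain ⟨T, hT, hT'⟩ := hφ.exists_isQuad_iterate k C C hd
  rcases hT.contracts_or_nearId with hc | ⟨n, hn, hS⟩
  · left
    obtain ⟨y, hy, hlim⟩ := exists_fixed_of_contracts hc
    refine ⟨C.pt y, ⟨k + 1, k.succ_pos, by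
      rw [Function.IsPeriodicPt, Function.IsFixedPt, hT', hy]⟩, mem_basin_orbit hL fun ε hε => ?_⟩
    obtain ⟨m, hm⟩ := (Metric.tendsto_atTop.mp (hlim 0)) (p * ε) (by positivity)
    refine ⟨(k + 1) * m, ?_⟩
    rw [iterate_mul_pt hT', C.dist_pt, div_lt_iff₀ hp, mul_comm ε, ← dist_eq_norm]
    exact hm m le_rfl
  · have hiter : ∀ m, φ^[(k + 1) * n * m] (C.pt 0) = C.pt ((T^[n])^[m] 0) :=
      fun m => iterate_mul_pt (iterate_mul_pt hT' n) m 0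
    by_cases h0 : T^[n] 0 = 0
    · refine Or.inl ⟨C.pt 0, ⟨(k + 1) * n, by positivity, ?_⟩,
        subset_basin_of_mapsTo (mapsTo_orbit _ _) (mem_orbit_self _ _)⟩
      rw [Function.IsPeriodicPt, Function.IsFixedPt, iterate_mul_pt hT', h0]
    · have hδ : 0 < ‖T^[n] 0‖ := norm_pos_iff.mpr h0
      have hE := isMinimalComponent_closure_orbit (x := C.pt 0) (δ := ‖T^[n] 0‖ / p) hL
        (N := (k + 1) * n) (by positivity) (by positivity)
        (by
          rw [div_lt_one hp]
          exact (PadicInt.norm_le_one _).trans_lt hp1)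
        (fun m => by
          rw [hiter, C.dist_pt, hS.norm_iterate_sub, sub_zero]
          ring)
      exact Or.inr ⟨_, hE, subset_basin_of_mapsTo hE.2.2.1 (subset_closure (mem_orbit_self _ _))⟩

theorem exists_return_le {φ : P1 p → P1 p} (hL : LipschitzWith 1 φ) {y : P1 p}
    (hy : y ∈ Function.periodicPts φ) :
    ∃ k, (k ≠ 0 ∧ dist (φ^[k] y) y < 1) ∧ k ≤ p + 1 := by
  obtain ⟨r, hr⟩ := exists_residue (p := p)
  obtain ⟨i, j, hij, hrij⟩ :
      ∃ i j : Fin (p + 2), i < j ∧ r (φ^[j] y) = r (φ^[i] y) := by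
    obtain ⟨i, j, hne, h⟩ := Fintype.exists_ne_map_eq_of_card_lt
      (fun n : Fin (p + 2) => r (φ^[n] y)) (by simp [ZMod.card])
    rcases lt_or_gt_of_ne hne with h' | h'
    · exact ⟨i, j, h', h.symm⟩
    · exact ⟨j, i, h', h⟩
  have hij' : (i : ℕ) < j := hij
  refine ⟨j - i, ⟨by omega, ?_⟩, by omega⟩
  obtain ⟨n, hn, hny⟩ := hy
  -- Applying `φ^(ni-i)` returns `φ^i y` to `y` and carries `φ^j y` to `φ^(j-i) y`, without
  -- increasing their distance.
  have h1 := dist_iterate_le hL (n * i - i) (φ^[j] y) (φ^[i] y)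
  have hle : (i : ℕ) ≤ n * i := Nat.le_mul_of_pos_left _ hn
  have hfix : φ^[n * i] y = y := hny.mul_const i
  rw [← Function.iterate_add_apply, ← Function.iterate_add_apply, Nat.sub_add_cancel hle, hfix,
    show n * i - i + j = (j - i) + n * i by omega, Function.iterate_add_apply, hfix] at h1
  exact h1.trans_lt (hr _ _ hrij)

/-- Here `k` is the first return time to the disc of `y`. It divides the period, and the quotient
`m` is the period of `0` under the return map. -/
theorem HasIntegralLift.minimalPeriod {φ : P1 p → P1 p} (hφ : HasIntegralLift φ) {y : P1 p}
    (hy : y ∈ Function.periodicPts φ) :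
    ∃ k ℓ : ℕ, 1 ≤ k ∧ k ≤ p + 1 ∧ ℓ ∣ p - 1 ∧
      (Function.minimalPeriod φ y = k ∨ Function.minimalPeriod φ y = k * ℓ ∨
        ((p = 2 ∨ p = 3) ∧ Function.minimalPeriod φ y = k * p)) := by
  classical
  have hL := hφ.lipschitz
  obtain ⟨k₀, hk₀, hk₀p⟩ := exists_return_le hL hy
  have hex : ∃ k, k ≠ 0 ∧ dist (φ^[k] y) y < 1 := ⟨k₀, hk₀⟩
  obtain ⟨k, hk⟩ : ∃ k, k = Nat.find hex := ⟨_, rfl⟩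
  obtain ⟨hk0, hkd⟩ : k ≠ 0 ∧ dist (φ^[k] y) y < 1 := hk ▸ Nat.find_spec hex
  have hkmin : ∀ m < k, ¬ (m ≠ 0 ∧ dist (φ^[m] y) y < 1) := fun m hm =>
    Nat.find_min hex (hk ▸ hm)
  have hkp : k ≤ p + 1 := by
    rw [hk]
    exact (Nat.find_min' hex hk₀).trans hk₀p
  set n := Function.minimalPeriod φ y with hn
  have hn0 : 0 < n := Function.minimalPeriod_pos_of_mem_periodicPts hy
  obtain ⟨k', rfl⟩ := Nat.exists_eq_succ_of_ne_zero hk0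
  obtain ⟨C, hC⟩ := Chart.exists_pt_zero_eq y
  obtain ⟨T, hT, hT'⟩ := hφ.exists_isQuad_iterate k' C C (by rw [hC]; exact hkd)
  have hiter : ∀ m, φ^[(k' + 1) * m] y = C.pt (T^[m] 0) := fun m => by
    rw [← hC]
    exact iterate_mul_pt hT' m 0
  have hdvd : k' + 1 ∣ n := by
    refine Nat.dvd_of_mod_eq_zero ?_
    by_contra hr
    refine hkmin (n % (k' + 1)) (Nat.mod_lt _ k'.succ_pos) ⟨hr, ?_⟩
    -- A nonzero remainder of the period modulo `k` would be an earlier return to the disc.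
    have h1 := dist_iterate_le hL (n % (k' + 1)) y (φ^[(k' + 1) * (n / (k' + 1))] y)
    rw [← Function.iterate_add_apply, Nat.mod_add_div] at h1
    have h2 : φ^[n] y = y := Function.iterate_minimalPeriod
    rw [h2] at h1
    refine h1.trans_lt ?_
    rw [hiter, ← hC]
    exact C.dist_pt_lt_one _ _
  obtain ⟨m, hm⟩ := hdvd
  have hm0 : m ≠ 0 := by
    rintro rfl
    omega
  have hdiv : ∀ j, T^[j] 0 = 0 → m ∣ j := fun j hj => by
    have h1 : Function.IsPeriodicPt φ ((k' + 1) * j) y := by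
      rw [Function.IsPeriodicPt, Function.IsFixedPt, hiter, hj, hC]
    have h2 := h1.minimalPeriod_dvd
    rw [← hn, hm] at h2
    exact Nat.dvd_of_mul_dvd_mul_left k'.succ_pos h2
  have hTm : T^[m] 0 = 0 := by
    apply C.pt_injective
    rw [← hiter, ← hm, hC]
    exact Function.iterate_minimalPeriod
  rcases hT.period hm0 hTm with h | h | ⟨h23, h⟩
  · have h1 : m = 1 := Nat.dvd_one.mp (hdiv 1 h)
    exact ⟨k' + 1, 1, by omega, hkp, one_dvd _, Or.inl (by rw [hm, h1, mul_one])⟩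
  · exact ⟨k' + 1, m, by omega, hkp, hdiv _ h, Or.inr (Or.inl hm)⟩
  · rcases (Nat.dvd_prime Fact.out).mp (hdiv _ h) with h1 | h1
    · exact ⟨k' + 1, 1, by omega, hkp, one_dvd _, Or.inl (by rw [hm, h1, mul_one])⟩
    · exact ⟨k' + 1, 1, by omega, hkp, one_dvd _, Or.inr (Or.inr ⟨h23, by rw [hm, h1]⟩)⟩

/-! ### Clopen sets -/

theorem isFiniteUnionOfBalls_of_isClopen {E : Set (P1 p)} (hE : IsClopen E) :
    IsFiniteUnionOfBalls p E := by
  have hp1 : (1 : ℝ) < p := by exact_mod_cast (Fact.out : p.Prime).one_lt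
  have key : ∀ x : P1 p, ∃ n : ℕ, 1 ≤ n ∧ (x ∈ E → sphBall p n x ⊆ E) := by
    intro x
    by_cases hx : x ∈ E
    · obtain ⟨ε, hε, hball⟩ := Metric.isOpen_iff.mp hE.isOpen x hx
      obtain ⟨t, ht⟩ := exists_pow_lt_of_lt_one hε (inv_lt_one_of_one_lt₀ hp1)
      refine ⟨t + 1, by omega, fun _ => (Metric.closedBall_subset_ball ?_).trans hball⟩
      refine lt_of_le_of_lt ?_ ht
      rw [zpow_neg, zpow_natCast, ← inv_pow]
      exact pow_le_pow_of_le_one (by positivity) (inv_le_one_of_one_le₀ hp1.le) (Nat.le_succ t)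
    -- Outside `E` the radius plays no role; 1 is a default.
    · exact ⟨1, le_rfl, fun h => absurd h hx⟩
  choose n hn hnE using key
  obtain ⟨t, htE, htc⟩ := hE.isClosed.isCompact.elim_nhds_subcover (fun x => sphBall p (n x) x)
    fun x _ => Metric.closedBall_mem_nhds x (by positivity)
  refine ⟨(fun x => (n x, x)) '' t, t.finite_toSet.image _, ?_, ?_⟩
  · rintro _ ⟨x, -, rfl⟩
    exact hn x
  · rw [Set.biUnion_image]
    refine Set.Subset.antisymm (by simpa using htc) (Set.iUnion₂_subset fun x hx => ?_)
    exact hnE x (htE x hx)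

theorem countable_isMinimalComponent (φ : P1 p → P1 p) : {E | IsMinimalComponent φ E}.Countable :=
  (pairwiseDisjoint_isMinimalComponent φ).countable_of_isOpen (fun _ hE => hE.2.1.isOpen)
    fun _ hE => hE.1


/-! ### Numerators, denominators and homogeneous lifts -/

section Lift

variable {K : Type*} [Field K]

theorem exists_eq_num_mul {f g : K[X]} (hg : g ≠ 0) : ∃ h : K[X], h ≠ 0 ∧
    f = (algebraMap K[X] (RatFunc K) f / algebraMap K[X] (RatFunc K) g).num * h ∧
    g = (algebraMap K[X] (RatFunc K) f / algebraMap K[X] (RatFunc K) g).denom * h := by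
  set ψ := algebraMap K[X] (RatFunc K) f / algebraMap K[X] (RatFunc K) g with hψ
  obtain ⟨h, hh⟩ : ψ.denom ∣ g := RatFunc.denom_div_dvd f g
  have hg' : algebraMap K[X] (RatFunc K) g ≠ 0 := RatFunc.algebraMap_ne_zero hg
  have hd' : algebraMap K[X] (RatFunc K) ψ.denom ≠ 0 := RatFunc.algebraMap_ne_zero ψ.denom_ne_zero
  have h1 : ψ.num * g = f * ψ.denom := by
    apply RatFunc.algebraMap_injective K
    rw [map_mul, map_mul, ← div_eq_div_iff hd' hg', RatFunc.num_div_denom]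
  refine ⟨h, ?_, ?_, hh⟩
  · rintro rfl
    exact hg (by rw [hh, mul_zero])
  · apply mul_right_cancel₀ ψ.denom_ne_zero
    rw [← h1]
    nth_rewrite 1 [hh]
    ring

/-- If neither degree exceeds that of the quotient, the cancelled common factor can only be a
constant. -/
theorem exists_eq_C_mul_num {f g : K[X]} (hg : g ≠ 0)
    (hf' : f.natDegree ≤
      ratDegree (algebraMap K[X] (RatFunc K) f / algebraMap K[X] (RatFunc K) g))
    (hg' : g.natDegree ≤
      ratDegree (algebraMap K[X] (RatFunc K) f / algebraMap K[X] (RatFunc K) g)) :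
    ∃ c : K, c ≠ 0 ∧
    f = Polynomial.C c * (algebraMap K[X] (RatFunc K) f / algebraMap K[X] (RatFunc K) g).num ∧
    g = Polynomial.C c *
      (algebraMap K[X] (RatFunc K) f / algebraMap K[X] (RatFunc K) g).denom := by
  obtain ⟨h, h0, hfh, hgh⟩ := exists_eq_num_mul (f := f) hg
  generalize algebraMap K[X] (RatFunc K) f / algebraMap K[X] (RatFunc K) g = ψ at *
  have hdg : g.natDegree = ψ.denom.natDegree + h.natDegree := by
    rw [hgh, Polynomial.natDegree_mul ψ.denom_ne_zero h0]
  have hdeg : h.natDegree = 0 := by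
    rw [ratDegree] at hf' hg'
    rcases le_total ψ.num.natDegree ψ.denom.natDegree with hle | hle
    · rw [max_eq_right hle] at hg'
      omega
    · rw [max_eq_left hle] at hf' hg'
      by_cases hn : ψ.num = 0
      · rw [hn, Polynomial.natDegree_zero] at hg'
        omega
      · rw [hfh, Polynomial.natDegree_mul hn h0] at hf'
        omega
  obtain ⟨c, rfl⟩ := Polynomial.natDegree_eq_zero.mp hdeg
  refine ⟨c, fun hc => h0 (by rw [hc, map_zero]), ?_, ?_⟩
  · rw [hfh]; ring
  · rw [hgh]; ring

theorem natDegree_le_ratDegree_of_isCoprime {f g : K[X]} (hfg : IsCoprime f g) (hg : g ≠ 0) :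
    f.natDegree ≤
      ratDegree (algebraMap K[X] (RatFunc K) f / algebraMap K[X] (RatFunc K) g) ∧
    g.natDegree ≤
      ratDegree (algebraMap K[X] (RatFunc K) f / algebraMap K[X] (RatFunc K) g) := by
  obtain ⟨h, h0, hfh, hgh⟩ := exists_eq_num_mul (f := f) hg
  generalize algebraMap K[X] (RatFunc K) f / algebraMap K[X] (RatFunc K) g = ψ at *
  have hu : IsUnit h := hfg.isUnit_of_dvd' ⟨_, hfh.trans (mul_comm _ _)⟩
    ⟨_, hgh.trans (mul_comm _ _)⟩
  have hdeg := Polynomial.natDegree_eq_zero_of_isUnit hu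
  constructor
  · rw [hfh]
    refine Polynomial.natDegree_mul_le.trans ?_
    rw [hdeg, add_zero]
    exact le_max_left _ _
  · rw [hgh]
    refine Polynomial.natDegree_mul_le.trans ?_
    rw [hdeg, add_zero]
    exact le_max_right _ _

/-- The map `(x, y) ↦ (F (x, y), G (x, y))` given by the homogenizations of degree `d` of two
polynomials. -/
def pairLift (d : ℕ) (f g : K[X]) (v : Fin 2 → K) : Fin 2 → K := ![homEval d f v, homEval d g v]

theorem homEval_C_mul (d : ℕ) (c : K) (f : K[X]) (v : Fin 2 → K) :
    homEval d (Polynomial.C c * f) v = c * homEval d f v := by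
  simp [homEval, Finset.mul_sum, mul_assoc]

theorem pairLift_C_mul (d : ℕ) (c : K) (f g : K[X]) (v : Fin 2 → K) :
    pairLift d (Polynomial.C c * f) (Polynomial.C c * g) v = c • pairLift d f g v := by
  funext i
  fin_cases i <;> simp [pairLift, homEval_C_mul]

theorem exists_pairLift_eq_smul {f g : K[X]} (hg : g ≠ 0)
    (hf' : f.natDegree ≤
      ratDegree (algebraMap K[X] (RatFunc K) f / algebraMap K[X] (RatFunc K) g))
    (hg' : g.natDegree ≤
      ratDegree (algebraMap K[X] (RatFunc K) f / algebraMap K[X] (RatFunc K) g)) :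
    ∃ c : K, c ≠ 0 ∧ ∀ v,
      pairLift (ratDegree (algebraMap K[X] (RatFunc K) f / algebraMap K[X] (RatFunc K) g)) f g v =
      c • homLift (algebraMap K[X] (RatFunc K) f / algebraMap K[X] (RatFunc K) g) v := by
  obtain ⟨c, hc, h1, h2⟩ := exists_eq_C_mul_num hg hf' hg'
  generalize algebraMap K[X] (RatFunc K) f / algebraMap K[X] (RatFunc K) g = ψ at *
  refine ⟨c, hc, fun v => ?_⟩
  rw [h1, h2, pairLift_C_mul]
  rfl

theorem pairLift_ne_zero {f g : K[X]} (hg : g ≠ 0) {d : ℕ}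
    (hd : ratDegree (algebraMap K[X] (RatFunc K) f / algebraMap K[X] (RatFunc K) g) = d)
    (hf' : f.natDegree ≤ d) (hg' : g.natDegree ≤ d) {v : Fin 2 → K} (hv : v ≠ 0) :
    pairLift d f g v ≠ 0 := by
  subst hd
  obtain ⟨c, hc, h⟩ := exists_pairLift_eq_smul hg hf' hg'
  rw [h]
  exact smul_ne_zero hc (homLift_ne_zero _ hv)

theorem homEval_map {R : Type*} [CommRing R] (σ : R →+* K) (d : ℕ) (f : R[X]) (x y : R) :
    homEval d (f.map σ) ![σ x, σ y] = σ (homValue d f x y) := by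
  simp [homEval, homValue]

end Lift

/-! ### Good reduction gives an integral lift -/

theorem isCoprime_of_toZMod_ne_zero {a b : ℤ_[p]}
    (h : (![PadicInt.toZMod a, PadicInt.toZMod b] : Fin 2 → ZMod p) ≠ 0) : IsCoprime a b := by
  have key : ∀ z : ℤ_[p], PadicInt.toZMod z ≠ 0 → IsUnit z := fun z hz => by
    rw [Ne, toZMod_eq_zero_iff_dvd, ← PadicInt.norm_lt_one_iff_dvd, not_lt] at hz
    exact PadicInt.isUnit_iff.mpr (le_antisymm (PadicInt.norm_le_one _) hz)
  by_cases ha : PadicInt.toZMod a = 0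
  · have hb : PadicInt.toZMod b ≠ 0 := fun hb => h (by
      funext i
      fin_cases i
      · exact ha
      · exact hb)
    obtain ⟨s, hs⟩ := (key b hb).exists_left_inv
    exact ⟨0, s, by rw [zero_mul, zero_add, hs]⟩
  · obtain ⟨s, hs⟩ := (key a ha).exists_left_inv
    exact ⟨s, 0, by rw [zero_mul, add_zero, hs]⟩

theorem toZMod_ne_zero_of_isCoprime {a b : ℤ_[p]} (h : IsCoprime a b) :
    (![PadicInt.toZMod a, PadicInt.toZMod b] : Fin 2 → ZMod p) ≠ 0 := by
  intro h0
  have ha : PadicInt.toZMod a = 0 := congrFun h0 0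
  have hb : PadicInt.toZMod b = 0 := congrFun h0 1
  obtain ⟨s, t, hst⟩ := h
  have := congrArg PadicInt.toZMod hst
  simp [ha, hb] at this

theorem ratMap_mk {K : Type*} [Field K] (φ : RatFunc K) (v : Fin 2 → K) (hv : v ≠ 0) :
    ratMap φ (Projectivization.mk K v hv) =
      Projectivization.mk K (homLift φ v) (homLift_ne_zero φ hv) := rfl

/-- As the degree does not drop, nothing cancels in `f̄ / ḡ` and its forms of degree `deg φ` have no
common zero on the line over `𝔽_p`; so one of the two integral values at coprime coordinates is a
unit. -/
theorem GoodReduction.hasIntegralLift {φ : RatFunc ℚ_[p]} (hdeg : 1 ≤ ratDegree φ)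
    (h : GoodReduction p φ) : HasIntegralLift (ratMap φ) := by
  obtain ⟨f, g, hfg, hφ, hg0, -, hred⟩ := h
  have hinj : Function.Injective (algebraMap ℤ_[p] ℚ_[p]) := IsFractionRing.injective _ _
  have hg0' : g.map (algebraMap ℤ_[p] ℚ_[p]) ≠ 0 := (Polynomial.map_ne_zero_iff hinj).mpr hg0
  obtain ⟨hdf, hdg⟩ := natDegree_le_ratDegree_of_isCoprime hfg hg0'
  obtain ⟨c, hc, hlift⟩ := exists_pairLift_eq_smul hg0' hdf hdg
  rw [← hφ] at hdf hdg hlift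
  rw [Polynomial.natDegree_map_eq_of_injective hinj] at hdf hdg
  -- If `ḡ = 0`, the quotient is 0 by convention, of degree 0, against `deg φ ≥ 1`.
  have hgbar : g.map (PadicInt.toZMod (p := p)) ≠ 0 := by
    intro h0
    rw [h0, map_zero, div_zero] at hred
    simp [ratDegree] at hred
    rw [ratDegree] at hdeg
    omega
  refine ⟨ratDegree φ, f, g, fun x y hxy => ?_⟩
  have hne := pairLift_ne_zero hgbar hred (Polynomial.natDegree_map_le.trans hdf)
    (Polynomial.natDegree_map_le.trans hdg) (toZMod_ne_zero_of_isCoprime hxy)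
  rw [pairLift, homEval_map, homEval_map] at hne
  refine ⟨isCoprime_of_toZMod_ne_zero hne, ?_⟩
  rw [toP1, ratMap_mk, toP1, Projectivization.mk_eq_mk_iff']
  have h1 := hlift ![algebraMap ℤ_[p] ℚ_[p] x, algebraMap ℤ_[p] ℚ_[p] y]
  rw [pairLift, homEval_map, homEval_map] at h1
  refine ⟨c⁻¹, ?_⟩
  change c⁻¹ • ![algebraMap ℤ_[p] ℚ_[p] _, algebraMap ℤ_[p] ℚ_[p] _] = _
  rw [h1, smul_smul, inv_mul_cancel₀ hc, one_smul]
  rfl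

/-! ### Iterates of a rational map have finitely many fixed points -/

section Iterate

variable {K L : Type*} [Field K] [Field L]

/-- The dehomogenized forms defining the `n`-th iterate of the map defined by `a` and `b`. -/
noncomputable def iterForms (d : ℕ) (a b : K[X]) : ℕ → K[X] × K[X]
  | 0 => (Polynomial.X, 1)
  | n + 1 => (homValue d (a.map Polynomial.C) (iterForms d a b n).1 (iterForms d a b n).2,
      homValue d (b.map Polynomial.C) (iterForms d a b n).1 (iterForms d a b n).2)

theorem map_homValue {R S : Type*} [CommRing R] [CommRing S] (τ : R →+* S) (d : ℕ) (f : R[X])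
    (x y : R) : τ (homValue d f x y) = homValue d (f.map τ) (τ x) (τ y) := by
  simp [homValue]

theorem iterForms_map (σ : K →+* L) (d : ℕ) (a b : K[X]) (n : ℕ) :
    (iterForms d (a.map σ) (b.map σ) n) =
      ((iterForms d a b n).1.map σ, (iterForms d a b n).2.map σ) := by
  induction n with
  | zero => simp [iterForms]
  | succ n ih =>
    have hC : ∀ f : K[X], (f.map Polynomial.C).map (Polynomial.mapRingHom σ) =
        (f.map σ).map Polynomial.C := fun f => by
      rw [Polynomial.map_map, Polynomial.map_map, Polynomial.mapRingHom_comp_C]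
    have h1 : ∀ (f : K[X]) (x y : K[X]), (homValue d (f.map Polynomial.C) x y).map σ =
        homValue d ((f.map σ).map Polynomial.C) (x.map σ) (y.map σ) := fun f x y => by
      have := map_homValue (Polynomial.mapRingHom σ) d (f.map Polynomial.C) x y
      rw [hC] at this
      exact this
    simp only [iterForms]
    rw [h1, h1, ih]

theorem natDegree_homValue_le {d m : ℕ} (a f g : K[X]) (hf : f.natDegree ≤ m)
    (hg : g.natDegree ≤ m) : (homValue d (a.map Polynomial.C) f g).natDegree ≤ m * d := by
  refine Polynomial.natDegree_sum_le_of_forall_le _ _ fun i hi => ?_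
  have hi' : i ≤ d := Nat.lt_succ_iff.mp (Finset.mem_range.mp hi)
  rw [Polynomial.coeff_map, mul_assoc]
  refine (Polynomial.natDegree_C_mul_le _ _).trans (Polynomial.natDegree_mul_le.trans ?_)
  have h1 := (Polynomial.natDegree_pow_le (p := f) (n := i)).trans (Nat.mul_le_mul_left i hf)
  have h2 := (Polynomial.natDegree_pow_le (p := g) (n := d - i)).trans
    (Nat.mul_le_mul_left (d - i) hg)
  calc _ ≤ i * m + (d - i) * m := add_le_add h1 h2
    _ = m * d := by rw [← add_mul, Nat.add_sub_cancel' hi', mul_comm]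

theorem natDegree_iterForms_le (d : ℕ) (a b : K[X]) (n : ℕ) :
    (iterForms d a b n).1.natDegree ≤ d ^ n ∧ (iterForms d a b n).2.natDegree ≤ d ^ n := by
  induction n with
  | zero => simp [iterForms]
  | succ n ih =>
    rw [pow_succ]
    exact ⟨natDegree_homValue_le a _ _ ih.1 ih.2, natDegree_homValue_le b _ _ ih.1 ih.2⟩

theorem homEval_mul {m k : ℕ} {f g : K[X]} (hf : f.natDegree ≤ m) (hg : g.natDegree ≤ k)
    (v : Fin 2 → K) : homEval (m + k) (f * g) v = homEval m f v * homEval k g v := by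
  by_cases hv : v 1 = 0
  · rw [homEval_of_eq_zero _ _ hv, homEval_of_eq_zero _ _ hv, homEval_of_eq_zero _ _ hv,
      Polynomial.coeff_mul_add_eq_of_natDegree_le hf hg]
    ring
  · rw [homEval_eq_eval (Polynomial.natDegree_mul_le.trans (add_le_add hf hg)) hv,
      homEval_eq_eval hf hv, homEval_eq_eval hg hv, Polynomial.eval_mul]
    ring

theorem homEval_pow {m : ℕ} {f : K[X]} (hf : f.natDegree ≤ m) (i : ℕ) (v : Fin 2 → K) :
    homEval (m * i) (f ^ i) v = homEval m f v ^ i := by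
  induction i with
  | zero => simp [homEval]
  | succ i ih =>
    have h1 : (f ^ i).natDegree ≤ m * i := by
      rw [mul_comm]
      exact Polynomial.natDegree_pow_le.trans (Nat.mul_le_mul_left i hf)
    rw [mul_add, mul_one, pow_succ, pow_succ, homEval_mul h1 hf, ih]

theorem homEval_sum {ι : Type*} (s : Finset ι) (d : ℕ) (f : ι → K[X]) (v : Fin 2 → K) :
    homEval d (∑ i ∈ s, f i) v = ∑ i ∈ s, homEval d (f i) v := by
  simp only [homEval, Polynomial.finsetSum_coeff, Finset.sum_mul]
  exact Finset.sum_comm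

/-- Homogenization commutes with substitution, so the dehomogenized recursion computes the iterates
of the homogeneous lift. -/
theorem homEval_homValue {d m : ℕ} (a : K[X]) {f g : K[X]} (hf : f.natDegree ≤ m)
    (hg : g.natDegree ≤ m) (v : Fin 2 → K) :
    homEval (m * d) (homValue d (a.map Polynomial.C) f g) v = homEval d a (pairLift m f g v) := by
  rw [homValue, homEval_sum]
  unfold homEval pairLift
  refine Finset.sum_congr rfl fun i hi => ?_
  have hi' : i ≤ d := Nat.lt_succ_iff.mp (Finset.mem_range.mp hi)
  have h1 : (f ^ i).natDegree ≤ m * i := by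
    rw [mul_comm]
    exact Polynomial.natDegree_pow_le.trans (Nat.mul_le_mul_left i hf)
  have h2 : (g ^ (d - i)).natDegree ≤ m * (d - i) := by
    rw [mul_comm]
    exact Polynomial.natDegree_pow_le.trans (Nat.mul_le_mul_left _ hg)
  have h3 := homEval_mul h1 h2 v
  rw [← mul_add, Nat.add_sub_cancel' hi', homEval_pow hf, homEval_pow hg] at h3
  have h4 := homEval_C_mul (m * d) (a.coeff i) (f ^ i * g ^ (d - i)) v
  rw [h3] at h4
  rw [Polynomial.coeff_map, mul_assoc]
  refine h4.trans ?_
  simp [mul_assoc]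

theorem pairLift_iterForms (d : ℕ) (a b : K[X]) (n : ℕ) (v : Fin 2 → K) :
    pairLift (d ^ n) (iterForms d a b n).1 (iterForms d a b n).2 v =
      (pairLift d a b)^[n] v := by
  induction n with
  | zero =>
    funext i
    fin_cases i <;> simp [pairLift, iterForms, homEval,
      Polynomial.coeff_X, Polynomial.coeff_one]
  | succ n ih =>
    obtain ⟨h1, h2⟩ := natDegree_iterForms_le d a b n
    rw [Function.iterate_succ_apply', ← ih, pow_succ]
    simp only [pairLift, iterForms]
    rw [homEval_homValue a h1 h2, homEval_homValue b h1 h2]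
    rfl

theorem iterate_pairLift_ne_zero {d : ℕ} {a b : K[X]}
    (h : ∀ v : Fin 2 → K, v ≠ 0 → pairLift d a b v ≠ 0) (n : ℕ) {v : Fin 2 → K} (hv : v ≠ 0) :
    (pairLift d a b)^[n] v ≠ 0 := by
  induction n with
  | zero => exact hv
  | succ n ih =>
    rw [Function.iterate_succ_apply']
    exact h _ ih

theorem vec_one_ne_zero (z : K) : (![z, 1] : Fin 2 → K) ≠ 0 := fun h => by
  simpa using congrFun h 1

theorem vec_one_zero_ne_zero : (![1, 0] : Fin 2 → K) ≠ 0 := fun h => by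
  simpa using congrFun h 0

/-- Over an algebraically closed field, an iterate of a map of degree at least two is not the
identity. -/
theorem iterForms_ne_of_isAlgClosed [IsAlgClosed K] {d : ℕ} (hd : 2 ≤ d) {a b : K[X]}
    (h : ∀ v : Fin 2 → K, v ≠ 0 → pairLift d a b v ≠ 0) {n : ℕ} (hn : n ≠ 0) :
    (iterForms d a b n).1 ≠ Polynomial.X * (iterForms d a b n).2 := by
  intro heq
  have hlift := pairLift_iterForms d a b n
  obtain ⟨hdf, hdg⟩ := natDegree_iterForms_le d a b n
  have hD : 2 ≤ d ^ n := hd.trans (Nat.le_self_pow hn d)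
  generalize (iterForms d a b n).1 = f at *
  generalize (iterForms d a b n).2 = g at *
  -- If `f = X g`, the two forms acquire a common zero: at infinity when `g` is constant, because
  -- their degree is at least 2, and otherwise at a root of `g` (the case `g = 0` included).
  by_cases hg : g.degree = 0
  · rw [Polynomial.eq_C_of_degree_eq_zero hg] at heq hlift
    refine iterate_pairLift_ne_zero h n (v := ![1, 0]) vec_one_zero_ne_zero ?_
    rw [← hlift, heq]
    funext i
    fin_cases i
    · simp only [pairLift, Fin.zero_eta, Matrix.cons_val_zero, Pi.zero_apply]
      rw [homEval_of_eq_zero _ _ (by simp), mul_comm Polynomial.X, Polynomial.coeff_C_mul_X,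
        if_neg (by omega), zero_mul]
    · simp only [pairLift, Fin.mk_one, Matrix.cons_val_one, Matrix.cons_val_fin_one, Pi.zero_apply]
      rw [homEval_of_eq_zero _ _ (by simp), Polynomial.coeff_C_of_ne_zero (by omega), zero_mul]
  · obtain ⟨z, hz⟩ := IsAlgClosed.exists_root g hg
    refine iterate_pairLift_ne_zero h n (vec_one_ne_zero z) ?_
    rw [← hlift]
    have hz' : g.eval z = 0 := hz
    funext i
    fin_cases i
    · simp only [pairLift, Fin.zero_eta, Matrix.cons_val_zero, Pi.zero_apply]
      rw [homEval_eq_eval hdf (by simp), heq]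
      simp [hz']
    · simp only [pairLift, Fin.mk_one, Matrix.cons_val_one, Matrix.cons_val_fin_one, Pi.zero_apply]
      rw [homEval_eq_eval hdg (by simp)]
      simp [hz']

/-- The root of `g` may lie outside `K`; coprimality and degrees are unchanged over the algebraic
closure. -/
theorem iterForms_num_denom_ne {φ : RatFunc K} (hd : 2 ≤ ratDegree φ) {n : ℕ} (hn : n ≠ 0) :
    (iterForms (ratDegree φ) φ.num φ.denom n).1 ≠
      Polynomial.X * (iterForms (ratDegree φ) φ.num φ.denom n).2 := by
  intro heq
  set σ := algebraMap K (AlgebraicClosure K) with hσ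
  have hden : φ.denom.map σ ≠ 0 := (Polynomial.map_ne_zero_iff σ.injective).mpr φ.denom_ne_zero
  have hcop : IsCoprime (φ.num.map σ) (φ.denom.map σ) :=
    φ.isCoprime_num_denom.map (Polynomial.mapRingHom σ)
  obtain ⟨h1, h2⟩ := natDegree_le_ratDegree_of_isCoprime hcop hden
  have hd' : ratDegree (algebraMap _ (RatFunc (AlgebraicClosure K)) (φ.num.map σ) /
      algebraMap _ (RatFunc (AlgebraicClosure K)) (φ.denom.map σ)) = ratDegree φ := by
    obtain ⟨c, hc, e1, e2⟩ := exists_eq_C_mul_num hden h1 h2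
    have e1' := congrArg Polynomial.natDegree e1
    have e2' := congrArg Polynomial.natDegree e2
    rw [Polynomial.natDegree_C_mul hc, Polynomial.natDegree_map] at e1' e2'
    rw [ratDegree, ratDegree, ← e1', ← e2']
  refine iterForms_ne_of_isAlgClosed hd (a := φ.num.map σ) (b := φ.denom.map σ)
    (fun v hv => pairLift_ne_zero hden hd' ?_ ?_ hv) hn ?_
  · exact hd' ▸ h1
  · exact hd' ▸ h2
  · rw [iterForms_map]
    simp [heq]

theorem iterate_ratMap_mk (φ : RatFunc K) (n : ℕ) (v : Fin 2 → K) (hv : v ≠ 0) :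
    ∃ h, (ratMap φ)^[n] (Projectivization.mk K v hv) =
      Projectivization.mk K ((homLift φ)^[n] v) h := by
  induction n with
  | zero => exact ⟨hv, rfl⟩
  | succ n ih =>
    obtain ⟨h, hh⟩ := ih
    rw [Function.iterate_succ_apply', Function.iterate_succ_apply', hh, ratMap_mk]
    exact ⟨homLift_ne_zero φ h, rfl⟩

/-- Apart from infinity, a fixed point is a root of the nonzero polynomial `f - X g`. -/
theorem finite_fixedPoints_iterate {φ : RatFunc K} (hd : 2 ≤ ratDegree φ) {n : ℕ} (hn : n ≠ 0) :
    {P | (ratMap φ)^[n] P = P}.Finite := by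
  set f := (iterForms (ratDegree φ) φ.num φ.denom n).1 with hf
  set g := (iterForms (ratDegree φ) φ.num φ.denom n).2 with hg
  have hq : f - Polynomial.X * g ≠ 0 := sub_ne_zero.mpr (iterForms_num_denom_ne hd hn)
  classical
  refine (((f - Polynomial.X * g).roots.toFinset.finite_toSet.image fun z =>
    Projectivization.mk K ![z, 1] (vec_one_ne_zero z)).insert
    (Projectivization.mk K ![1, 0] vec_one_zero_ne_zero)).subset ?_
  intro P hP
  induction P using Projectivization.ind with
  | h v hv =>
    by_cases hv1 : v 1 = 0
    · left
      rw [Projectivization.mk_eq_mk_iff']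
      refine ⟨v 0, ?_⟩
      funext i
      fin_cases i <;> simp [hv1]
    · right
      have hPz : Projectivization.mk K v hv =
          Projectivization.mk K ![v 0 / v 1, 1] (vec_one_ne_zero _) := by
        rw [Projectivization.mk_eq_mk_iff']
        refine ⟨v 1, ?_⟩
        funext i
        fin_cases i <;> simp [mul_div_cancel₀ _ hv1]
      refine ⟨v 0 / v 1, ?_, hPz.symm⟩
      change (ratMap φ)^[n] _ = _ at hP
      rw [hPz] at hP
      generalize v 0 / v 1 = z at hP
      obtain ⟨h, hh⟩ := iterate_ratMap_mk φ n _ (vec_one_ne_zero z)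
      rw [hh, Projectivization.mk_eq_mk_iff'] at hP
      obtain ⟨t, ht⟩ := hP
      obtain ⟨hdf, hdg⟩ := natDegree_iterForms_le (ratDegree φ) φ.num φ.denom n
      have hl : pairLift (ratDegree φ ^ n) f g ![z, 1] = (homLift φ)^[n] ![z, 1] :=
        pairLift_iterForms _ _ _ _ _
      rw [← ht] at hl
      have h0 := congrFun hl 0
      have h1 := congrFun hl 1
      simp only [pairLift, Matrix.cons_val_zero, Matrix.cons_val_one, Matrix.cons_val_fin_one,
        Pi.smul_apply, smul_eq_mul, mul_one] at h0 h1
      rw [homEval_eq_eval hdf (by simp)] at h0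
      rw [homEval_eq_eval hdg (by simp)] at h1
      simp only [Matrix.cons_val_zero, Matrix.cons_val_one, Matrix.cons_val_fin_one, one_pow,
        one_mul, div_one] at h0 h1
      rw [Finset.mem_coe, Multiset.mem_toFinset, Polynomial.mem_roots hq, Polynomial.IsRoot,
        Polynomial.eval_sub, Polynomial.eval_mul, Polynomial.eval_X, h0, h1]
      ring

end Iterate

end PadicRat

/-! ### The main theorem -/

theorem theorem1p2 (p : ℕ) [Fact p.Prime] (φ : RatFunc ℚ_[p])
    (hdeg : 2 ≤ PadicRat.ratDegree φ) (hgood : PadicRat.GoodReduction p φ) :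
    (∃ P M B : Set (PadicRat.P1 p),
      -- the decomposition
      P ∪ M ∪ B = Set.univ ∧ Disjoint P M ∧ Disjoint P B ∧ Disjoint M B ∧
      -- the periodic part
      P = Function.periodicPts (PadicRat.ratMap φ) ∧ P.Finite ∧
      -- the minimal part
      M = ⋃₀ {E | PadicRat.IsMinimalComponent (PadicRat.ratMap φ) E} ∧
      {E | PadicRat.IsMinimalComponent (PadicRat.ratMap φ) E}.Countable ∧
      {E | PadicRat.IsMinimalComponent (PadicRat.ratMap φ) E}.PairwiseDisjoint id ∧
      (∀ E, PadicRat.IsMinimalComponent (PadicRat.ratMap φ) E →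
        PadicRat.IsFiniteUnionOfBalls p E) ∧
      -- the attracted part
      (∀ x ∈ B,
        (∃ y ∈ Function.periodicPts (PadicRat.ratMap φ),
          x ∈ PadicRat.basin (PadicRat.ratMap φ) (PadicRat.orbit (PadicRat.ratMap φ) y)) ∨
        (∃ E, PadicRat.IsMinimalComponent (PadicRat.ratMap φ) E ∧
          x ∈ PadicRat.basin (PadicRat.ratMap φ) E))) ∧
    -- the lengths of the periodic orbits
    (∀ y ∈ Function.periodicPts (PadicRat.ratMap φ),
      ∃ k ℓ : ℕ, 1 ≤ k ∧ k ≤ p + 1 ∧ ℓ ∣ p - 1 ∧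
        (Function.minimalPeriod (PadicRat.ratMap φ) y = k ∨
          Function.minimalPeriod (PadicRat.ratMap φ) y = k * ℓ ∨
          ((p = 2 ∨ p = 3) ∧ Function.minimalPeriod (PadicRat.ratMap φ) y = k * p))) := by
  have hφ : PadicRat.HasIntegralLift (PadicRat.ratMap φ) :=
    hgood.hasIntegralLift (one_le_two.trans hdeg)
  have hpp : p.Prime := Fact.out
  have hper := fun y hy => hφ.minimalPeriod (y := y) hy
  refine ⟨⟨Function.periodicPts (PadicRat.ratMap φ),
    ⋃₀ {E | PadicRat.IsMinimalComponent (PadicRat.ratMap φ) E},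
    (Function.periodicPts (PadicRat.ratMap φ) ∪
      ⋃₀ {E | PadicRat.IsMinimalComponent (PadicRat.ratMap φ) E})ᶜ,
    Set.union_compl_self _, ?_, ?_, ?_, rfl, ?_, rfl,
    PadicRat.countable_isMinimalComponent _, PadicRat.pairwiseDisjoint_isMinimalComponent _,
    fun E hE => PadicRat.isFiniteUnionOfBalls_of_isClopen hE.2.1,
    fun x _ => hφ.exists_attractor x⟩, hper⟩
  · exact Set.disjoint_sUnion_right.mpr fun E hE =>
      PadicRat.IsMinimalComponent.disjoint_periodicPts hE
  · exact Set.disjoint_left.mpr fun x hx hx' => hx' (Or.inl hx)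
  · exact Set.disjoint_left.mpr fun x hx hx' => hx' (Or.inr hx)
  -- All three forms of the period are at most `(p + 1) p`, so finitely many fixed-point sets cover
  -- the periodic points.
  · refine (Set.Finite.biUnion (Set.finite_Icc 1 ((p + 1) * p)) fun n hn =>
      PadicRat.finite_fixedPoints_iterate hdeg (Nat.one_le_iff_ne_zero.mp hn.1)).subset
      fun y hy => ?_
    refine Set.mem_iUnion₂.mpr ⟨Function.minimalPeriod (PadicRat.ratMap φ) y,
      ⟨Function.minimalPeriod_pos_of_mem_periodicPts hy, ?_⟩, Function.iterate_minimalPeriod⟩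
    obtain ⟨k, l, -, hk, hl, h | h | ⟨-, h⟩⟩ := hper y hy
    · rw [h]
      exact hk.trans (Nat.le_mul_of_pos_right _ hpp.pos)
    · rw [h]
      have h1 : l ≤ p - 1 := Nat.le_of_dvd (by have := hpp.two_le; omega) hl
      exact Nat.mul_le_mul hk (by omega)
    · rw [h]
      exact Nat.mul_le_mul_right _ hk
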